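/- Let $n\ge 2$ and $Q=[0,1]^n$. A measurable function $f:Q\to\mathbb R$ is approximately differentiable at $x\in Q$, with approximate derivative the linear function $L=\operatorname{ap}Df(x):\mathbb R^n\to\mathbb R$, if there is a Lebesgue measurable set $E_x\subset Q$ with $\lim_{\rho\to0^+}|E_x\cap B(x,\rho)|/|B(x,\rho)|=1$ and $\lim_{E_x\ni y\to x}|f(y)-f(x)-L(y-x)|/|y-x|=0$; for maps into $\mathbb R^n$ the notion is understood componentwise. Then there exist a homeomorphism $\Phi$ of $Q$ onto itself and a compact set $A\subset\operatorname{int}Q$ such that: 1. $\Phi$ is approximately differentiable at almost every point of $Q$, and $\Phi$ has the Lusin property (N): if $N\subset Q$ and $|N|=0$, then $|\Phi(N)|=0$; 2. $\Phi$ is the identity in a neighborhood of $\partial Q$; 3. $A$ is a Cantor set, i.e. homeomorphic to the ternary Cantor set, and $|A|=2^{-n}$; 4. $\Phi(x_1,\dots,x_{n-1},x_n)=(x_1,\dots,x_{n-1},1-x_n)$ for all $x\in A$, and $\Phi(A)=A$; 5. $\Phi$ restricts to a $C^\infty$-diffeomorphism of $Q\setminus A$ onto itself; 6. $\operatorname{ap}D\Phi(x)=\operatorname{diag}(1,\dots,1,-1)$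 for almost every $x\in A$; 7. $\Phi$ is orientation preserving, i.e. its extension to $\mathbb R^n$ by the identity has local topological (Brouwer) degree $1$ at every point of $Q$, whereas its Jacobian $J_\Phi=\det\operatorname{ap}D\Phi$ changes sign: each of the sets $\{x\in Q: J_\Phi(x)>0\}$ and $\{x\in Q: J_\Phi(x)<0\}$ has positive measure. -/

import Mathlib

open Set Filter Topology MeasureTheory
open scoped ContDiff ENNReal

noncomputable section

/-- The closed unit cube `[0,1]^n` in Euclidean space. -/
def unitCube (n : ℕ) : Set (EuclideanSpace ℝ (Fin n)) :=
  {x | ∀ i, x i ∈ Icc (0 : ℝ) 1}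

/-- The self-map of `ℝ^n` that agrees with `Φ` on the unit cube and is the identity off it. -/
def extendById {n : ℕ} (Φ : unitCube n ≃ₜ unitCube n) (x : EuclideanSpace ℝ (Fin n)) :
    EuclideanSpace ℝ (Fin n) :=
  open Classical in if h : x ∈ unitCube n then (Φ ⟨x, h⟩ : EuclideanSpace ℝ (Fin n)) else x

/-- `x` is a density point of `T`: `|T ∩ B(x,ρ)| / |B(x,ρ)| → 1` as `ρ → 0+`. -/
def IsDensityPoint {n : ℕ} (T : Set (EuclideanSpace ℝ (Fin n)))
    (x : EuclideanSpace ℝ (Fin n)) : Prop :=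
  Tendsto (fun ρ : ℝ => volume (T ∩ Metric.ball x ρ) / volume (Metric.ball x ρ))
    (𝓝[>] 0) (𝓝 1)

/-- The real function `f` on the set `S` is approximately differentiable at `x ∈ S`, with
approximate derivative `L`: there is a Lebesgue measurable `T ⊆ S` having `x` as a density point
along which `|f y - f x - L (y - x)| / |y - x| → 0` as `y → x`, `y ≠ x`. -/
def HasApproxDeriv {n : ℕ} (S : Set (EuclideanSpace ℝ (Fin n)))
    (f : EuclideanSpace ℝ (Fin n) → ℝ) (L : EuclideanSpace ℝ (Fin n) →L[ℝ] ℝ)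
    (x : EuclideanSpace ℝ (Fin n)) : Prop :=
  x ∈ S ∧ ∃ T ⊆ S, NullMeasurableSet T volume ∧ IsDensityPoint T x ∧
    Tendsto (fun y => |f y - f x - L (y - x)| / ‖y - x‖) (𝓝[T \ {x}] x) (𝓝 0)

/-- The map `f : S → ℝ^n` has approximate derivative `L` at `x`: each component of `f` has the
corresponding component of `L` as its approximate derivative. -/
def HasApproxFDeriv {n : ℕ} (S : Set (EuclideanSpace ℝ (Fin n)))
    (f : EuclideanSpace ℝ (Fin n) → EuclideanSpace ℝ (Fin n))
    (L : EuclideanSpace ℝ (Fin n) →L[ℝ] EuclideanSpace ℝ (Fin n))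
    (x : EuclideanSpace ℝ (Fin n)) : Prop :=
  ∀ i : Fin n, HasApproxDeriv S (fun y => f y i)
    ((EuclideanSpace.proj i : EuclideanSpace ℝ (Fin n) →L[ℝ] ℝ).comp L) x

/-- Lusin's property (N) on `S`: null subsets of `S` have null images. -/
def LusinN {n : ℕ} (S : Set (EuclideanSpace ℝ (Fin n)))
    (f : EuclideanSpace ℝ (Fin n) → EuclideanSpace ℝ (Fin n)) : Prop :=
  ∀ N ⊆ S, volume N = 0 → volume (f '' N) = 0

/-- The reflection `(x_1, …, x_{n-1}, x_n) ↦ (x_1, …, x_{n-1}, 1 - x_n)`. -/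
def reflectLast {n : ℕ} (x : EuclideanSpace ℝ (Fin n)) : EuclideanSpace ℝ (Fin n) :=
  WithLp.toLp 2 fun i => if (i : ℕ) + 1 = n then 1 - x i else x i

/-- The linear map with matrix `diag (1, …, 1, -1)`. -/
def diagLast (n : ℕ) : EuclideanSpace ℝ (Fin n) →L[ℝ] EuclideanSpace ℝ (Fin n) :=
  Matrix.toEuclideanCLM (𝕜 := ℝ)
    (Matrix.diagonal fun i : Fin n => if (i : ℕ) + 1 = n then (-1 : ℝ) else 1)

/-- `d` is the Brouwer degree at `p` of the continuous map `f` on the closure of the bounded open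
set `Ω`, where `p ∉ f (∂Ω)`. It is computed, as usual, from a smooth `g` on `Ω` (continuous up to
the boundary) that is uniformly closer to `f` than the distance from `p` to `f (∂Ω)` and for which
`p` is a regular value: `d` is the sum of the signs of `det Dg` over the (finite) fibre of `g`
over `p`. The result does not depend on the choice of `g`. -/
def IsBrouwerDegree {n : ℕ} (f : EuclideanSpace ℝ (Fin n) → EuclideanSpace ℝ (Fin n))
    (Ω : Set (EuclideanSpace ℝ (Fin n))) (p : EuclideanSpace ℝ (Fin n)) (d : ℤ) : Prop :=
  p ∉ f '' frontier Ω ∧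
  ∃ g : EuclideanSpace ℝ (Fin n) → EuclideanSpace ℝ (Fin n),
    ContDiffOn ℝ ∞ g Ω ∧ ContinuousOn g (closure Ω) ∧
    (∀ x ∈ closure Ω, ‖g x - f x‖ < Metric.infDist p (f '' frontier Ω)) ∧
    (∀ x ∈ Ω, g x = p → (fderiv ℝ g x).det ≠ 0) ∧
    {x ∈ Ω | g x = p}.Finite ∧
    d = ∑ᶠ x ∈ {x ∈ Ω | g x = p}, (SignType.sign (fderiv ℝ g x).det : ℤ)

/-- A homeomorphism `Φ` of the unit cube that is the identity on the boundary is orientation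
preserving: its extension by the identity has local degree `1` at every point `x` of the cube. The
local degree at `x` of an injective map is its degree at the value of `x` on any ball around `x`. -/
def OrientationPreserving {n : ℕ} (Φ : unitCube n ≃ₜ unitCube n) : Prop :=
  ∀ x ∈ unitCube n, ∀ r : ℝ, 0 < r →
    IsBrouwerDegree (extendById Φ) (Metric.ball x r) (extendById Φ x) 1

end

/-! The set `A` is the power of a fat Cantor set symmetric about `1/2`. The reflection reverses
orientation, but on a totally disconnected set it is a limit of maps that only translate. When the
children of a cube lie in an upper and a lower slab, the slabs can be exchanged by translations, and
since `n ≥ 2` there is room to do so by a diffeomorphism supported in the cube: half-turn a ball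
containing both, then undo the half-turn inside each (`exists_swap_balls`, `exists_swap_slabs`).

Applying this exchange in every cube of generation `k` gives a diffeomorphism `G k`
(`exists_swap_children`). The composites `P (k + 1) = P k ∘ G k` translate each cube of generation
`k` onto its mirror image. As the cubes shrink geometrically, `P k` and the inverses converge
uniformly, so the limit `F` is a homeomorphism (`exists_reflecting_homeomorph`). It equals `P k` off
the cubes of generation `k`, hence is smooth off `A`, and it is the reflection on `A`.

Almost every point of `A` is a density point of `A`, so the approximate derivative there is that of
the reflection, with determinant `-1`. Yet each `P k` is the identity near a corner of the unit
cube, so its Jacobian determinant is positive everywhere, and uniform approximation by `P k` gives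
`F` local degree `1`. Property (N) holds because `F` is differentiable off `A` and agrees with an
affine map on `A`. -/

/-! ### Smooth permutations -/

/-- A permutation of a normed space that is smooth together with its inverse. -/
def IsSmoothPerm {E : Type*} [NormedAddCommGroup E] [NormedSpace ℝ E] (f : Equiv.Perm E) : Prop :=
  ContDiff ℝ ∞ f ∧ ContDiff ℝ ∞ f.symm

namespace IsSmoothPerm

variable {E : Type*} [NormedAddCommGroup E] [NormedSpace ℝ E] {f g : Equiv.Perm E}

theorem refl : IsSmoothPerm (Equiv.refl E) := ⟨contDiff_id, contDiff_id⟩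

theorem symm (hf : IsSmoothPerm f) : IsSmoothPerm f.symm := ⟨hf.2, hf.1⟩

theorem trans (hf : IsSmoothPerm f) (hg : IsSmoothPerm g) : IsSmoothPerm (f.trans g) :=
  ⟨hg.1.comp hf.1, hf.2.comp hg.2⟩

theorem det_ne_zero [FiniteDimensional ℝ E] (hf : IsSmoothPerm f) (x : E) :
    (fderiv ℝ f x).det ≠ 0 := by
  have h1 : DifferentiableAt ℝ f x := (hf.1.differentiable (by simp)) x
  have h2 : DifferentiableAt ℝ f.symm (f x) := (hf.2.differentiable (by simp)) (f x)
  have h3 : HasFDerivAt (f.symm ∘ f) ((fderiv ℝ f.symm (f x)).comp (fderiv ℝ f x)) x :=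
    h2.hasFDerivAt.comp x h1.hasFDerivAt
  have h4 : (fderiv ℝ f.symm (f x)).comp (fderiv ℝ f x) = ContinuousLinearMap.id ℝ E := by
    refine h3.unique ?_
    have : (f.symm ∘ f : E → E) = id := by ext; simp
    rw [this]; exact hasFDerivAt_id x
  intro h
  have h5 : ((fderiv ℝ f.symm (f x)).comp (fderiv ℝ f x)).det = 1 := by
    rw [h4]; simp [ContinuousLinearMap.det]
  have h6 : ((fderiv ℝ f.symm (f x)).comp (fderiv ℝ f x)).det
      = (fderiv ℝ f.symm (f x)).det * (fderiv ℝ f x).det := by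
    simp [ContinuousLinearMap.det]
  rw [h6, h] at h5
  simp at h5

/-- A smooth permutation that is the identity near some point preserves orientation. -/
theorem det_pos [FiniteDimensional ℝ E] (hf : IsSmoothPerm f) {p : E} (hp : f =ᶠ[𝓝 p] id) (x : E) :
    0 < (fderiv ℝ f x).det := by
  have hc : Continuous fun x => (fderiv ℝ f x).det :=
    ContinuousLinearMap.continuous_det.comp (hf.1.continuous_fderiv (by simp))
  have h1 : (fderiv ℝ f p).det = 1 := by
    rw [hp.fderiv_eq, fderiv_id]; simp [ContinuousLinearMap.det]
  by_contra! hx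
  obtain ⟨y, hy⟩ := mem_range_of_exists_le_of_exists_ge hc ⟨x, hx⟩ ⟨p, by rw [h1]; norm_num⟩
  exact hf.det_ne_zero y hy

end IsSmoothPerm

/-- The linear term keeps the derivative positive where `φ` is flat, so the inverse is smooth. On
the plateaus of `φ` the map is affine of slope `ε`, which is how it is used below. -/
theorem exists_isSmoothPerm_linear_add {ε : ℝ} (hε : 0 < ε) {φ : ℝ → ℝ} (hφ : ContDiff ℝ ∞ φ)
    (hm : Monotone φ) : ∃ f : Equiv.Perm ℝ, IsSmoothPerm f ∧ ∀ t, f t = ε * t + φ t := by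
  set F : ℝ → ℝ := fun t => ε * t + φ t with hF
  have hFc : ContDiff ℝ ∞ F := (contDiff_const.mul contDiff_id).add hφ
  have hsm : StrictMono F := fun a b hab =>
    add_lt_add_of_lt_of_le ((mul_lt_mul_iff_right₀ hε).2 hab) (hm hab.le)
  have htop : Tendsto F atTop atTop := by
    refine tendsto_atTop_mono' atTop (f₁ := fun t => ε * t + φ 0) ?_
      (tendsto_atTop_add_const_right _ _ (tendsto_id.const_mul_atTop hε))
    filter_upwards [eventually_ge_atTop 0] with t ht
    exact add_le_add le_rfl (hm ht)
  have hbot : Tendsto F atBot atBot := by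
    refine tendsto_atBot_mono' atBot (f₁ := fun t => ε * t + φ 0) ?_
      (tendsto_atBot_add_const_right _ _ (tendsto_id.const_mul_atBot hε))
    filter_upwards [eventually_le_atBot 0] with t ht
    exact add_le_add le_rfl (hm ht)
  have hsurj : Function.Surjective F := hFc.continuous.surjective htop hbot
  let e : ℝ ≃ₜ ℝ := (hsm.orderIsoOfSurjective F hsurj).toHomeomorph
  have he : (e : ℝ → ℝ) = F := rfl
  have hd : ∀ t, HasDerivAt F (ε + deriv φ t) t := fun t => by
    have h1 := ((hasDerivAt_id t).const_mul ε).add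
      ((hφ.differentiable (by simp)) t).hasDerivAt
    rw [mul_one] at h1; exact h1
  refine ⟨e.toEquiv, ⟨hFc, ?_⟩, fun t => rfl⟩
  refine e.contDiff_symm_deriv (f' := fun t => ε + deriv φ t) (fun t => ?_) hd hFc
  have : 0 ≤ deriv φ t := hm.deriv_nonneg
  positivity

/-- The product of one-dimensional permutations, acting on Euclidean space. -/
def piPerm {ι : Type*} (f : ι → Equiv.Perm ℝ) : Equiv.Perm (EuclideanSpace ℝ ι) where
  toFun x := WithLp.toLp 2 fun i => f i (x i)
  invFun x := WithLp.toLp 2 fun i => (f i).symm (x i)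
  left_inv x := by ext; simp
  right_inv x := by ext; simp

theorem IsSmoothPerm.piPerm {ι : Type*} [Fintype ι] {f : ι → Equiv.Perm ℝ}
    (hf : ∀ i, IsSmoothPerm (f i)) : IsSmoothPerm (piPerm f) :=
  ⟨contDiff_euclidean.2 fun i => (hf i).1.comp (contDiff_piLp_apply (p := 2) (i := i)),
    contDiff_euclidean.2 fun i => (hf i).2.comp (contDiff_piLp_apply (p := 2) (i := i))⟩

/-! ### Rotations, twists and the exchange of two balls -/

section Twist

variable {E : Type*} [NormedAddCommGroup E] [InnerProductSpace ℝ E]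

/-- Rotation by the angle `t` in the plane spanned by the orthonormal vectors `e` and `f`. -/
noncomputable def planeRot (e f : E) (t : ℝ) (v : E) : E :=
  v + ((Real.cos t - 1) * inner ℝ e v - Real.sin t * inner ℝ f v) • e
    + (Real.sin t * inner ℝ e v + (Real.cos t - 1) * inner ℝ f v) • f

variable {e f : E}

theorem planeRot_zero (v : E) : planeRot e f 0 v = v := by simp [planeRot]

theorem planeRot_neg_planeRot (he : ‖e‖ = 1) (hf : ‖f‖ = 1) (hef : inner ℝ e f = 0) (t : ℝ) (v : E) :
    planeRot e f (-t) (planeRot e f t v) = v := by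
  have hee : inner ℝ e e = (1 : ℝ) := by rw [real_inner_self_eq_norm_sq, he]; norm_num
  have hff : inner ℝ f f = (1 : ℝ) := by rw [real_inner_self_eq_norm_sq, hf]; norm_num
  have hfe : inner ℝ f e = (0 : ℝ) := by rw [real_inner_comm, hef]
  simp only [planeRot, inner_add_right, inner_smul_right, hee, hff, hef, hfe, Real.cos_neg,
    Real.sin_neg]
  have hcs := Real.sin_sq_add_cos_sq t
  generalize inner ℝ e v = a
  generalize inner ℝ f v = b
  generalize Real.sin t = s at *
  generalize Real.cos t = c at *
  have h1 : ∀ p q p' q' : ℝ, p + p' = 0 → q + q' = 0 →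
      v + p • e + q • f + p' • e + q' • f = v := by
    intro p q p' q' hp hq
    rw [show v + p • e + q • f + p' • e + q' • f = v + (p + p') • e + (q + q') • f by module,
      hp, hq]
    simp
  apply h1
  · linear_combination a * hcs
  · linear_combination b * hcs

theorem norm_planeRot (he : ‖e‖ = 1) (hf : ‖f‖ = 1) (hef : inner ℝ e f = 0) (t : ℝ) (v : E) :
    ‖planeRot e f t v‖ = ‖v‖ := by
  have hee : inner ℝ e e = (1 : ℝ) := by rw [real_inner_self_eq_norm_sq, he]; norm_num
  have hff : inner ℝ f f = (1 : ℝ) := by rw [real_inner_self_eq_norm_sq, hf]; norm_num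
  have hfe : inner ℝ f e = (0 : ℝ) := by rw [real_inner_comm, hef]
  have h : ‖planeRot e f t v‖ ^ 2 = ‖v‖ ^ 2 := by
    rw [← real_inner_self_eq_norm_sq, ← real_inner_self_eq_norm_sq]
    simp only [planeRot, inner_add_right, inner_add_left, inner_smul_right, inner_smul_left, hee,
      hff, hef, hfe, real_inner_comm e v, real_inner_comm f v, conj_trivial]
    have hcs := Real.sin_sq_add_cos_sq t
    generalize inner ℝ e v = a
    generalize inner ℝ f v = b
    generalize Real.sin t = s at *
    generalize Real.cos t = c at *
    linear_combination (a ^ 2 + b ^ 2) * hcs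
  exact (pow_left_inj₀ (norm_nonneg _) (norm_nonneg _) two_ne_zero).1 h

/-- The twist about `c`: each sphere about `c` is rotated by an angle depending on its radius. -/
noncomputable def twist (e f : E) (he : ‖e‖ = 1) (hf : ‖f‖ = 1) (hef : inner ℝ e f = 0) (c : E)
    (θ : ℝ → ℝ) : Equiv.Perm E where
  toFun x := c + planeRot e f (θ (‖x - c‖ ^ 2)) (x - c)
  invFun x := c + planeRot e f (-θ (‖x - c‖ ^ 2)) (x - c)
  left_inv x := by
    simp only [add_sub_cancel_left, norm_planeRot he hf hef, planeRot_neg_planeRot he hf hef]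
    abel
  right_inv x := by
    have := planeRot_neg_planeRot he hf hef (-θ (‖x - c‖ ^ 2)) (x - c)
    rw [neg_neg] at this
    simp only [add_sub_cancel_left, norm_planeRot he hf hef, this]
    abel

theorem isSmoothPerm_twist (he : ‖e‖ = 1) (hf : ‖f‖ = 1) (hef : inner ℝ e f = 0) (c : E)
    {θ : ℝ → ℝ} (hθ : ContDiff ℝ ∞ θ) : IsSmoothPerm (twist e f he hf hef c θ) := by
  have key : ∀ η : ℝ → ℝ, ContDiff ℝ ∞ η →
      ContDiff ℝ ∞ fun x => c + planeRot e f (η (‖x - c‖ ^ 2)) (x - c) := by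
    intro η hη
    have h1 : ContDiff ℝ ∞ fun x : E => x - c := contDiff_id.sub contDiff_const
    have h2 : ContDiff ℝ ∞ fun x : E => η (‖x - c‖ ^ 2) := hη.comp (h1.norm_sq ℝ)
    have h3 : ContDiff ℝ ∞ fun x : E => inner ℝ e (x - c) := contDiff_const.inner ℝ h1
    have h4 : ContDiff ℝ ∞ fun x : E => inner ℝ f (x - c) := contDiff_const.inner ℝ h1
    have hc := Real.contDiff_cos.comp h2
    have hs := Real.contDiff_sin.comp h2
    exact contDiff_const.add ((h1.add ((((hc.sub contDiff_const).mul h3).sub (hs.mul h4)).smul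
      contDiff_const)).add (((hs.mul h3).add ((hc.sub contDiff_const).mul h4)).smul contDiff_const))
  exact ⟨key θ hθ, key (fun t => -θ t) hθ.neg⟩

/-- A twist whose angle is cut off from `π` to `0` between the radii `a` and `b`. The angle is a
function of the squared radius, so that it is smooth at the centre. -/
theorem exists_half_turn (he : ‖e‖ = 1) (hf : ‖f‖ = 1) (hef : inner ℝ e f = 0) (c : E) {a b : ℝ}
    (ha : 0 ≤ a) (hab : a < b) : ∃ T : Equiv.Perm E, IsSmoothPerm T ∧
      (∀ v, ‖v‖ ≤ a → T (c + v) = c + planeRot e f Real.pi v) ∧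
      ∀ x, b ≤ ‖x - c‖ → T x = x := by
  have hab2 : 0 < b ^ 2 - a ^ 2 := by nlinarith
  set θ : ℝ → ℝ := fun t => Real.pi * Real.smoothTransition ((b ^ 2 - t) / (b ^ 2 - a ^ 2)) with hθ
  have hθs : ContDiff ℝ ∞ θ := contDiff_const.mul (Real.smoothTransition.contDiff.comp
    ((contDiff_const.sub contDiff_id).div_const _))
  refine ⟨twist e f he hf hef c θ, isSmoothPerm_twist he hf hef c hθs, fun v hv => ?_,
    fun x hx => ?_⟩
  · have h1 : θ (‖v‖ ^ 2) = Real.pi := by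
      simp only [hθ]
      rw [Real.smoothTransition.one_of_one_le, mul_one]
      rw [le_div_iff₀ hab2]
      nlinarith [norm_nonneg v]
    simp [twist, h1]
  · have h1 : θ (‖x - c‖ ^ 2) = 0 := by
      simp only [hθ]
      rw [Real.smoothTransition.zero_of_nonpos, mul_zero]
      apply div_nonpos_of_nonpos_of_nonneg _ hab2.le
      nlinarith
    simp [twist, h1, planeRot_zero]

theorem planeRot_pi (v : E) :
    planeRot e f Real.pi v = v - (2 * inner ℝ e v) • e - (2 * inner ℝ f v) • f := by
  simp only [planeRot, Real.cos_pi, Real.sin_pi]; module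

/-- The half-turn `T0` of the large ball exchanges the small balls about `±q • f` but also turns
each by `π`. The half-turns `T1`, `T2` about their centres cancel that, leaving translations. The
range of `q` keeps the supports of `T1` and `T2`, of radius `3/8`, apart and inside the unit ball,
and the balls of radius `1/4` inside the region where `T0` is rigid. -/
theorem exists_swap_balls (he : ‖e‖ = 1) (hf : ‖f‖ = 1) (hef : inner ℝ e f = 0) {q : ℝ}
    (hq : 1 / 2 ≤ q) (hq' : q ≤ 9 / 16) : ∃ T : Equiv.Perm E, IsSmoothPerm T ∧
      (∀ x, 1 ≤ ‖x‖ → T x = x) ∧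
      ∀ v, ‖v‖ ≤ 1 / 4 → T (q • f + v) = -(q • f) + v ∧ T (-(q • f) + v) = q • f + v := by
  obtain ⟨T0, s0, i0, o0⟩ := exists_half_turn he hf hef 0 (a := 7 / 8) (b := 1) (by norm_num)
    (by norm_num)
  obtain ⟨T1, s1, i1, o1⟩ := exists_half_turn he hf hef (q • f) (a := 1 / 4) (b := 3 / 8)
    (by norm_num) (by norm_num)
  obtain ⟨T2, s2, i2, o2⟩ := exists_half_turn he hf hef (-(q • f)) (a := 1 / 4) (b := 3 / 8)
    (by norm_num) (by norm_num)
  have hqn : ‖q • f‖ = q := by rw [norm_smul, hf, mul_one, Real.norm_of_nonneg (by linarith)]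
  have hff : inner ℝ f f = (1 : ℝ) := by rw [real_inner_self_eq_norm_sq, hf]; norm_num
  have hp : ∀ v, planeRot e f Real.pi (q • f + v) = -(q • f) + planeRot e f Real.pi v := by
    intro v
    simp only [planeRot_pi, inner_add_right, inner_smul_right, hef, hff]; module
  have hp' : ∀ v, planeRot e f Real.pi (-(q • f) + v) = q • f + planeRot e f Real.pi v := by
    intro v
    simp only [planeRot_pi, inner_add_right, inner_neg_right, inner_smul_right, hef, hff]; module
  have hn := norm_planeRot he hf hef Real.pi
  have hpp : ∀ v, planeRot e f Real.pi (planeRot e f Real.pi v) = v := by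
    intro v
    have := planeRot_neg_planeRot he hf hef Real.pi v
    rwa [show planeRot e f (-Real.pi) (planeRot e f Real.pi v)
      = planeRot e f Real.pi (planeRot e f Real.pi v) by simp [planeRot]] at this
  have hfar : ∀ v : E, ‖v‖ ≤ 1 / 4 → 3 / 8 ≤ ‖q • f + v - -(q • f)‖ := by
    intro v hv
    have h1 : ‖(2 : ℝ) • (q • f)‖ = 2 * q := by rw [norm_smul, hqn]; norm_num
    have h2 := norm_sub_norm_le ((2 : ℝ) • (q • f)) (-v)
    rw [show (2 : ℝ) • (q • f) - -v = q • f + v - -(q • f) by module, norm_neg, h1] at h2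
    linarith
  have hfar' : ∀ v : E, ‖v‖ ≤ 1 / 4 → 3 / 8 ≤ ‖-(q • f) + v - q • f‖ := by
    intro v hv
    have := hfar (-v) (by rwa [norm_neg])
    rw [← norm_neg, show -(q • f + -v - -(q • f)) = -(q • f) + v - q • f by module] at this
    exact this
  refine ⟨(T0.trans T1).trans T2, (s0.trans s1).trans s2, fun x hx => ?_, fun v hv => ⟨?_, ?_⟩⟩
  · have h1 : 3 / 8 ≤ ‖x - q • f‖ := by
      have := norm_sub_norm_le x (q • f); rw [hqn] at this; linarith
    have h2 : 3 / 8 ≤ ‖x - -(q • f)‖ := by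
      have := norm_sub_norm_le x (-(q • f)); rw [norm_neg, hqn] at this; linarith
    simp only [Equiv.trans_apply]
    rw [o0 x (by simpa using hx), o1 x h1, o2 x h2]
  · have h0 : ‖q • f + v‖ ≤ 7 / 8 := by
      have := norm_add_le (q • f) v; rw [hqn] at this; linarith
    have h1 := i0 _ h0
    simp only [zero_add] at h1
    simp only [Equiv.trans_apply]
    rw [h1, hp, o1 _ (hfar' _ (by rwa [hn])), i2 _ (by rwa [hn]), hpp]
  · have h0 : ‖-(q • f) + v‖ ≤ 7 / 8 := by
      have := norm_add_le (-(q • f)) v; rw [norm_neg, hqn] at this; linarith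
    have h1 := i0 _ h0
    simp only [zero_add] at h1
    simp only [Equiv.trans_apply]
    rw [h1, hp', i1 _ (by rwa [hn]), hpp, o2 _ (hfar _ hv)]

end Twist

/-! ### Exchanging two slabs of a cube -/

theorem EuclideanSpace.norm_le_card_mul {ι : Type*} [Fintype ι] {w : EuclideanSpace ℝ ι} {r : ℝ}
    (h : ∀ i, |w i| ≤ r) : ‖w‖ ≤ Fintype.card ι * r := by
  rcases isEmpty_or_nonempty ι with hι | ⟨⟨j⟩⟩
  · simp [Subsingleton.elim w 0]
  have hr : 0 ≤ r := (abs_nonneg _).trans (h j)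
  have hcard : 1 ≤ (Fintype.card ι : ℝ) := by
    have : 0 < Fintype.card ι := Fintype.card_pos_iff.2 ⟨j⟩
    exact_mod_cast this
  have h4 : ‖w‖ ^ 2 ≤ (Fintype.card ι * r) ^ 2 := by
    rw [EuclideanSpace.norm_sq_eq]
    refine (Finset.sum_le_sum fun i _ =>
      pow_le_pow_left₀ (norm_nonneg _) ((Real.norm_eq_abs _).le.trans (h i)) 2).trans ?_
    rw [Finset.sum_const, Finset.card_univ, nsmul_eq_mul]
    nlinarith [sq_nonneg r]
  exact (pow_le_pow_iff_left₀ (norm_nonneg _) (by positivity) two_ne_zero).1 h4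

/-- The exchange of balls is conjugated by a product `H` of one-dimensional diffeomorphisms. `H`
sends the complement of the cube outside the unit ball and is affine with the same linear part `ε`
on both slabs, so translations of balls pull back to translations of slabs. The slabs are wide
enough to hold all upper, respectively all lower, children of a cube. -/
theorem exists_swap_slabs {ι : Type*} [Fintype ι] [DecidableEq ι] {k l : ι} (hkl : k ≠ l) {s r : ℝ}
    (hs : 0 < s) (hsr : s < r / 2) : ∃ S : Equiv.Perm (EuclideanSpace ℝ ι), IsSmoothPerm S ∧
      (∀ x, (∃ i, r < |x i|) → S x = x) ∧
      ∀ w : EuclideanSpace ℝ ι, (∀ i ≠ l, |w i| ≤ r / 2 + s) → |w l| ≤ s →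
        S (EuclideanSpace.single l (r / 2) + w) = EuclideanSpace.single l (-(r / 2)) + w ∧
        S (EuclideanSpace.single l (-(r / 2)) + w) = EuclideanSpace.single l (r / 2) + w := by
  have hr : 0 < r := by linarith
  have hcard : 1 ≤ (Fintype.card ι : ℝ) := by
    have : 0 < Fintype.card ι := Fintype.card_pos_iff.2 ⟨k⟩
    exact_mod_cast this
  set N : ℝ := (Fintype.card ι : ℝ) with hN
  -- With `ε * (N * r) = 1/4`, vectors `w` in a slab have `‖ε • w‖ ≤ 1/4`. Since `N ≥ 2`, also `ε *
  -- (r / 2) ≤ 1/16`, whence `q ≤ 9/16`.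
  set ε : ℝ := 1 / (4 * N * r) with hεdef
  have hε : 0 < ε := by positivity
  have hεr : ε * (N * r) = 1 / 4 := by rw [hεdef]; field_simp
  set b : ℝ := r / 2 + s with hb
  have hbr : 0 < r - b := by linarith
  set a : ℝ := r / 2 - s with ha
  have ha0 : 0 < 2 * a := by linarith
  -- `φ` vanishes on `[-b, b]` and is `±1` beyond `±r`: it expels the outside of the cube. `ψ` is
  -- `±1/2` beyond `±a`: it separates the two slabs in the direction `l`.
  let φ : ℝ → ℝ := fun t => Real.smoothTransition ((t - b) / (r - b))
    - Real.smoothTransition ((-t - b) / (r - b))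
  let ψ : ℝ → ℝ := fun t => Real.smoothTransition ((t + a) / (2 * a)) - 1 / 2
  have hφs : ContDiff ℝ ∞ φ :=
    (Real.smoothTransition.contDiff.comp ((contDiff_id.sub contDiff_const).div_const _)).sub
      (Real.smoothTransition.contDiff.comp ((contDiff_neg.sub contDiff_const).div_const _))
  have hψs : ContDiff ℝ ∞ ψ :=
    (Real.smoothTransition.contDiff.comp ((contDiff_id.add contDiff_const).div_const _)).sub
      contDiff_const
  have hφm : Monotone φ := fun x y hxy => sub_le_sub
    (Real.smoothTransition.monotone (by gcongr)) (Real.smoothTransition.monotone (by gcongr))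
  have hψm : Monotone ψ := fun x y hxy => sub_le_sub_right
    (Real.smoothTransition.monotone (by gcongr)) _
  have hφ0 : ∀ t, |t| ≤ b → φ t = 0 := by
    intro t ht
    rw [abs_le] at ht
    simp only [φ]
    rw [Real.smoothTransition.zero_of_nonpos (div_nonpos_of_nonpos_of_nonneg (by linarith) hbr.le),
      Real.smoothTransition.zero_of_nonpos (div_nonpos_of_nonpos_of_nonneg (by linarith) hbr.le),
      sub_zero]
  have hφ1 : ∀ t, r < t → φ t = 1 := by
    intro t ht
    simp only [φ]
    rw [Real.smoothTransition.one_of_one_le ((one_le_div hbr).2 (by linarith)),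
      Real.smoothTransition.zero_of_nonpos (div_nonpos_of_nonpos_of_nonneg (by linarith) hbr.le),
      sub_zero]
  have hφ2 : ∀ t, t < -r → φ t = -1 := by
    intro t ht
    simp only [φ]
    rw [Real.smoothTransition.zero_of_nonpos (div_nonpos_of_nonpos_of_nonneg (by linarith) hbr.le),
      Real.smoothTransition.one_of_one_le ((one_le_div hbr).2 (by linarith)), zero_sub]
  have hψ1 : ∀ t, a ≤ t → ψ t = 1 / 2 := by
    intro t ht
    simp only [ψ]
    rw [Real.smoothTransition.one_of_one_le ((one_le_div ha0).2 (by linarith))]; norm_num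
  have hψ2 : ∀ t, t ≤ -a → ψ t = -(1 / 2) := by
    intro t ht
    simp only [ψ]
    rw [Real.smoothTransition.zero_of_nonpos (div_nonpos_of_nonpos_of_nonneg (by linarith) ha0.le)]
    norm_num
  obtain ⟨f, hf, hfe⟩ := exists_isSmoothPerm_linear_add hε hφs hφm
  obtain ⟨g, hg, hge⟩ := exists_isSmoothPerm_linear_add hε (hφs.add hψs) (hφm.add hψm)
  set H : Equiv.Perm (EuclideanSpace ℝ ι) := piPerm (fun i => if i = l then g else f) with hH
  have hHs : IsSmoothPerm H := IsSmoothPerm.piPerm fun i => by by_cases h : i = l <;> simp [h, hf, hg]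
  have hHl : ∀ x, H x l = g (x l) := fun x => by simp [hH, piPerm]
  have hHi : ∀ x, ∀ i ≠ l, H x i = f (x i) := fun x i hi => by simp [hH, piPerm, hi]
  set q : ℝ := ε * (r / 2) + 1 / 2 with hq
  have hq1 : 1 / 2 ≤ q := by have : 0 < ε * (r / 2) := by positivity
                             linarith
  have hcard2 : (2 : ℝ) ≤ N := by
    have : 2 ≤ Fintype.card ι := Fintype.one_lt_card_iff.2 ⟨k, l, hkl⟩
    rw [hN]; exact_mod_cast this
  have hq2 : q ≤ 9 / 16 := by nlinarith [mul_pos hε hr]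
  obtain ⟨T, hT, hTo, hTi⟩ := exists_swap_balls (E := EuclideanSpace ℝ ι)
    (e := EuclideanSpace.single k 1) (f := EuclideanSpace.single l 1) (by simp) (by simp)
    (by rw [EuclideanSpace.inner_single_left]; simp [hkl]) hq1 hq2
  have hplus : ∀ w : EuclideanSpace ℝ ι, (∀ i ≠ l, |w i| ≤ r / 2 + s) → |w l| ≤ s →
      H (EuclideanSpace.single l (r / 2) + w) = q • EuclideanSpace.single l 1 + ε • w := by
    intro w h1 h2
    have h3 := abs_le.1 h2
    ext i
    by_cases hi : i = l
    · subst hi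
      rw [hHl, hge]
      simp only [PiLp.add_apply, PiLp.single_apply, PiLp.smul_apply, smul_eq_mul, if_true]
      rw [hφ0, hψ1, hq]
      · ring
      · linarith
      · rw [abs_le]; constructor <;> linarith
    · rw [hHi _ _ hi, hfe]
      simp only [PiLp.add_apply, PiLp.single_apply, PiLp.smul_apply, smul_eq_mul, if_neg hi,
        zero_add]
      rw [hφ0 _ (h1 i hi)]; ring
  have hminus : ∀ w : EuclideanSpace ℝ ι, (∀ i ≠ l, |w i| ≤ r / 2 + s) → |w l| ≤ s →
      H (EuclideanSpace.single l (-(r / 2)) + w) = -(q • EuclideanSpace.single l 1) + ε • w := by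
    intro w h1 h2
    have h3 := abs_le.1 h2
    ext i
    by_cases hi : i = l
    · subst hi
      rw [hHl, hge]
      simp only [PiLp.add_apply, PiLp.single_apply, PiLp.smul_apply, smul_eq_mul, if_true,
        PiLp.neg_apply]
      rw [hφ0, hψ2, hq]
      · ring
      · linarith
      · rw [abs_le]; constructor <;> linarith
    · rw [hHi _ _ hi, hfe]
      simp only [PiLp.add_apply, PiLp.single_apply, PiLp.smul_apply, smul_eq_mul, if_neg hi,
        zero_add, PiLp.neg_apply, mul_zero, neg_zero]
      rw [hφ0 _ (h1 i hi)]; ring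
  have hsmall : ∀ w : EuclideanSpace ℝ ι, (∀ i ≠ l, |w i| ≤ r / 2 + s) → |w l| ≤ s →
      ‖ε • w‖ ≤ 1 / 4 := by
    intro w h1 h2
    have h5 : ‖w‖ ≤ N * r := EuclideanSpace.norm_le_card_mul fun i => by
      by_cases hi : i = l
      · subst hi; linarith
      · linarith [h1 i hi]
    rw [norm_smul, Real.norm_of_nonneg hε.le, ← hεr]
    gcongr
  refine ⟨(H.trans T).trans H.symm, (hHs.trans hT).trans hHs.symm, fun x ⟨i, hi⟩ => ?_,
    fun w h1 h2 => ⟨?_, ?_⟩⟩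
  · simp only [Equiv.trans_apply]
    rw [Equiv.symm_apply_eq]
    apply hTo
    refine le_trans ?_ (PiLp.norm_apply_le (H x) i)
    rw [Real.norm_eq_abs]
    rcases lt_abs.1 hi with h | h
    · refine le_trans ?_ (le_abs_self _)
      have h0 : 0 < ε * x i := mul_pos hε (by linarith)
      by_cases hil : i = l
      · subst hil
        rw [hHl, hge, hφ1 _ h, hψ1 _ (by linarith)]; linarith
      · rw [hHi _ _ hil, hfe, hφ1 _ h]; linarith
    · refine le_trans ?_ (neg_le_abs _)
      have h0 : 0 < ε * (- x i) := mul_pos hε (by linarith)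
      by_cases hil : i = l
      · subst hil
        rw [hHl, hge, hφ2 _ (by linarith), hψ2 _ (by linarith)]; linarith
      · rw [hHi _ _ hil, hfe, hφ2 _ (by linarith)]; linarith
  · simp only [Equiv.trans_apply]
    rw [Equiv.symm_apply_eq, hplus w h1 h2, hminus w h1 h2, (hTi _ (hsmall w h1 h2)).1]
  · simp only [Equiv.trans_apply]
    rw [Equiv.symm_apply_eq, hplus w h1 h2, hminus w h1 h2, (hTi _ (hsmall w h1 h2)).2]

/-! ### Gluing disjointly supported permutations -/

/-- Translated copies of a smooth permutation supported in `B`, placed in disjoint translates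
of `B`. -/
theorem exists_glue {E : Type*} [NormedAddCommGroup E] [NormedSpace ℝ E] (Z : Finset E) {B : Set E}
    (hZ : ∀ z ∈ Z, ∀ z' ∈ Z, ∀ x, x - z ∈ B → x - z' ∈ B → z = z') {S : Equiv.Perm E}
    (hS : IsSmoothPerm S) (hSB : ∀ x ∉ B, S x = x) : ∃ G : Equiv.Perm E, IsSmoothPerm G ∧
      (∀ z ∈ Z, ∀ x, x - z ∈ B → G x = z + S (x - z)) ∧
      ∀ x, (∀ z ∈ Z, x - z ∉ B) → G x = x := by
  have hSB' : ∀ x ∉ B, S.symm x = x := fun x hx => by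
    rw [Equiv.symm_apply_eq, hSB x hx]
  have hmem : ∀ x ∈ B, S x ∈ B := fun x hx => by
    by_contra h
    exact h (by rw [S.injective (hSB _ h)]; exact hx)
  have hmem' : ∀ x ∈ B, S.symm x ∈ B := fun x hx => by
    by_contra h
    exact h (by rw [S.symm.injective (hSB' _ h)]; exact hx)
  -- At each point at most one summand is nonzero, so the sum performs the right copy of `P`, and
  -- smoothness is evident without any patching.
  let F : Equiv.Perm E → E → E := fun P x => x + ∑ z ∈ Z, (P (x - z) - (x - z))
  have hFs : ∀ P : Equiv.Perm E, ContDiff ℝ ∞ P → ContDiff ℝ ∞ (F P) := by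
    intro P hP
    refine contDiff_id.add (ContDiff.sum fun z _ => ?_)
    have h1 : ContDiff ℝ ∞ fun x : E => x - z := contDiff_id.sub contDiff_const
    exact (hP.comp h1).sub h1
  have hFin : ∀ P : Equiv.Perm E, (∀ x ∉ B, P x = x) → ∀ z ∈ Z, ∀ x, x - z ∈ B →
      F P x = z + P (x - z) := by
    intro P hP z hz x hx
    simp only [F]
    rw [Finset.sum_eq_single_of_mem z hz]
    · abel
    · intro z' hz' hne
      rw [hP, sub_self]
      exact fun h => hne (hZ z' hz' z hz x h hx)
  have hFout : ∀ P : Equiv.Perm E, (∀ x ∉ B, P x = x) → ∀ x, (∀ z ∈ Z, x - z ∉ B) → F P x = x := by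
    intro P hP x hx
    simp only [F]
    rw [Finset.sum_eq_zero, add_zero]
    intro z hz
    rw [hP _ (hx z hz), sub_self]
  have hinv : ∀ P : Equiv.Perm E, (∀ x ∉ B, P x = x) → (∀ x ∉ B, P.symm x = x) →
      (∀ x ∈ B, P x ∈ B) → ∀ x, F P.symm (F P x) = x := by
    intro P h1 h2 h3 x
    by_cases hx : ∃ z ∈ Z, x - z ∈ B
    · obtain ⟨z, hz, hxz⟩ := hx
      rw [hFin P h1 z hz x hxz, hFin P.symm h2 z hz _ (by simpa using h3 _ hxz)]
      simp
    · push Not at hx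
      rw [hFout P h1 x hx, hFout P.symm h2 x hx]
  exact ⟨⟨F S, F S.symm, hinv S hSB hSB' hmem, hinv S.symm hSB' hSB hmem'⟩,
    ⟨hFs _ hS.1, hFs _ hS.2⟩, hFin S hSB, hFout S hSB⟩

/-! ### The fat Cantor set -/

/-- Half the length of the intervals of generation `k` of the fat Cantor set. -/
noncomputable def cantorRadius (k : ℕ) : ℝ := (1 / 2) ^ k / 4 + (1 / 4) ^ k / 8

/-- The midpoints of the intervals of generation `k` of the fat Cantor set. -/
noncomputable def cantorCenters : ℕ → Finset ℝ
  | 0 => {1 / 2}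
  | k + 1 => (cantorCenters k).image (fun z => z + cantorRadius k / 2) ∪
      (cantorCenters k).image (fun z => z - cantorRadius k / 2)

/-- The union of the intervals of generation `k` of the fat Cantor set. -/
def cantorLevel (k : ℕ) : Set ℝ := ⋃ z ∈ cantorCenters k, Metric.closedBall z (cantorRadius k)

/-- A Cantor subset of `[0,1]` of measure `1/2`, symmetric about `1/2`. -/
def fatCantor : Set ℝ := ⋂ k, cantorLevel k

theorem cantorRadius_pos (k : ℕ) : 0 < cantorRadius k := by unfold cantorRadius; positivity

theorem cantorRadius_succ_lt (k : ℕ) : cantorRadius (k + 1) < cantorRadius k / 2 := by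
  unfold cantorRadius
  have : (0 : ℝ) < (1 / 4) ^ k := by positivity
  rw [pow_succ, pow_succ]; linarith

theorem tendsto_cantorRadius : Tendsto cantorRadius atTop (𝓝 0) := by
  have h1 := (tendsto_pow_atTop_nhds_zero_of_lt_one (r := (1 / 2 : ℝ)) (by norm_num)
    (by norm_num)).div_const 4
  have h2 := (tendsto_pow_atTop_nhds_zero_of_lt_one (r := (1 / 4 : ℝ)) (by norm_num)
    (by norm_num)).div_const 8
  have h := h1.add h2
  rw [zero_div, zero_div, add_zero] at h
  exact h

theorem mem_cantorCenters_succ {k : ℕ} {z : ℝ} : z ∈ cantorCenters (k + 1) ↔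
    ∃ u ∈ cantorCenters k, z = u + cantorRadius k / 2 ∨ z = u - cantorRadius k / 2 := by
  simp only [cantorCenters, Finset.mem_union, Finset.mem_image]
  grind

theorem mem_cantorLevel {k : ℕ} {x : ℝ} :
    x ∈ cantorLevel k ↔ ∃ z ∈ cantorCenters k, |x - z| ≤ cantorRadius k := by
  simp [cantorLevel, Real.dist_eq]

/-- Siblings are `cantorRadius k` apart. Descendants of distinct parents have moved by `cantorRadius
k / 2` each from points more than `2 * cantorRadius k` apart. Both distances exceed `2 *
cantorRadius (k + 1)`. -/
theorem cantorCenters_separated {k : ℕ} {z z' : ℝ} (hz : z ∈ cantorCenters k)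
    (hz' : z' ∈ cantorCenters k) (hne : z ≠ z') : 2 * cantorRadius k < |z - z'| := by
  induction k generalizing z z' with
  | zero =>
    simp only [cantorCenters, Finset.mem_singleton] at hz hz'
    exact absurd (hz.trans hz'.symm) hne
  | succ k ih =>
    obtain ⟨u, hu, hzu⟩ := mem_cantorCenters_succ.1 hz
    obtain ⟨u', hu', hzu'⟩ := mem_cantorCenters_succ.1 hz'
    have h1 := cantorRadius_succ_lt k
    have h2 := cantorRadius_pos k
    by_cases huu : u = u'
    · subst huu
      rcases hzu with rfl | rfl <;> rcases hzu' with rfl | rfl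
      · exact absurd rfl hne
      · exact lt_of_lt_of_le (by linarith) (le_abs_self _)
      · exact lt_of_lt_of_le (by linarith) (neg_le_abs _)
      · exact absurd rfl hne
    · have h3 := ih hu hu' huu
      rcases lt_abs.1 h3 with h | h
      · refine lt_of_lt_of_le ?_ (le_abs_self _)
        rcases hzu with rfl | rfl <;> rcases hzu' with rfl | rfl <;> linarith
      · refine lt_of_lt_of_le ?_ (neg_le_abs _)
        rcases hzu with rfl | rfl <;> rcases hzu' with rfl | rfl <;> linarith

theorem cantorCenters_unique {k : ℕ} {x z z' : ℝ} (hz : z ∈ cantorCenters k)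
    (hz' : z' ∈ cantorCenters k) (hx : |x - z| ≤ cantorRadius k) (hx' : |x - z'| ≤ cantorRadius k) :
    z = z' := by
  by_contra h
  have h1 := cantorCenters_separated hz hz' h
  have h2 := abs_sub_le z x z'
  rw [abs_sub_comm z x] at h2
  linarith

theorem card_cantorCenters (k : ℕ) : (cantorCenters k).card = 2 ^ k := by
  induction k with
  | zero => simp [cantorCenters]
  | succ k ih =>
    rw [cantorCenters, Finset.card_union_of_disjoint, Finset.card_image_of_injective,
      Finset.card_image_of_injective, ih, pow_succ, mul_two]
    · exact sub_left_injective
    · exact add_left_injective _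
    · rw [Finset.disjoint_left]
      intro z hz hz'
      obtain ⟨u, hu, rfl⟩ := Finset.mem_image.1 hz
      obtain ⟨u', hu', h⟩ := Finset.mem_image.1 hz'
      have h0 := cantorRadius_pos k
      have : u = u' := cantorCenters_unique (x := u) hu hu' (by simpa using h0.le) (by
        rw [abs_le]; constructor <;> linarith)
      subst this
      linarith

theorem one_sub_mem_cantorCenters {k : ℕ} {z : ℝ} (hz : z ∈ cantorCenters k) :
    1 - z ∈ cantorCenters k := by
  induction k generalizing z with
  | zero =>
    simp only [cantorCenters, Finset.mem_singleton] at hz ⊢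
    rw [hz]; norm_num
  | succ k ih =>
    obtain ⟨u, hu, hzu⟩ := mem_cantorCenters_succ.1 hz
    refine mem_cantorCenters_succ.2 ⟨1 - u, ih hu, ?_⟩
    rcases hzu with rfl | rfl
    · right; ring
    · left; ring

theorem cantorLevel_succ_subset (k : ℕ) : cantorLevel (k + 1) ⊆ cantorLevel k := by
  intro x hx
  obtain ⟨z, hz, hxz⟩ := mem_cantorLevel.1 hx
  obtain ⟨u, hu, hzu⟩ := mem_cantorCenters_succ.1 hz
  have h1 := cantorRadius_succ_lt k
  refine mem_cantorLevel.2 ⟨u, hu, ?_⟩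
  rw [abs_le] at *
  rcases hzu with rfl | rfl <;> constructor <;> linarith

theorem antitone_cantorLevel : Antitone cantorLevel := antitone_nat_of_succ_le cantorLevel_succ_subset

theorem isCompact_cantorLevel (k : ℕ) : IsCompact (cantorLevel k) :=
  (cantorCenters k).isCompact_biUnion fun z _ => isCompact_closedBall z _

theorem isCompact_fatCantor : IsCompact fatCantor :=
  (isCompact_cantorLevel 0).of_isClosed_subset
    (isClosed_iInter fun k => (isCompact_cantorLevel k).isClosed) (iInter_subset _ 0)

theorem one_sub_mem_fatCantor {x : ℝ} (hx : x ∈ fatCantor) : 1 - x ∈ fatCantor := by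
  refine mem_iInter.2 fun k => ?_
  obtain ⟨z, hz, hxz⟩ := mem_cantorLevel.1 (mem_iInter.1 hx k)
  refine mem_cantorLevel.2 ⟨1 - z, one_sub_mem_cantorCenters hz, ?_⟩
  rwa [show 1 - x - (1 - z) = -(x - z) by ring, abs_neg]

/-- There are `2 ^ k` disjoint intervals of length `2 * cantorRadius k`. The radii are chosen so
that the total decreases to `1/2`. -/
theorem volume_cantorLevel (k : ℕ) :
    volume (cantorLevel k) = ENNReal.ofReal (1 / 2 + (1 / 2) ^ k / 4) := by
  rw [cantorLevel, measure_biUnion_finset]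
  · simp only [Real.volume_closedBall, Finset.sum_const, card_cantorCenters, nsmul_eq_mul]
    rw [Nat.cast_pow, Nat.cast_ofNat, show (2 : ℝ≥0∞) = ENNReal.ofReal 2 by simp,
      ← ENNReal.ofReal_pow (by norm_num), ← ENNReal.ofReal_mul (by positivity)]
    congr 1
    unfold cantorRadius
    have h1 : (2 : ℝ) ^ k * (1 / 2) ^ k = 1 := by rw [← mul_pow]; norm_num
    have h2 : (2 : ℝ) ^ k * (1 / 4) ^ k = (1 / 2) ^ k := by rw [← mul_pow]; norm_num
    linear_combination h1 / 2 + h2 / 4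
  · intro z hz z' hz' hne
    refine Set.disjoint_left.2 fun x hx hx' => hne (cantorCenters_unique hz hz' ?_ ?_ (x := x))
    · simpa [Real.dist_eq] using hx
    · simpa [Real.dist_eq] using hx'
  · exact fun z _ => measurableSet_closedBall

theorem volume_fatCantor : volume fatCantor = 1 / 2 := by
  have h1 : Tendsto (fun k => volume (cantorLevel k)) atTop (𝓝 (volume fatCantor)) :=
    tendsto_measure_iInter_atTop
      (fun k => (isCompact_cantorLevel k).measurableSet.nullMeasurableSet) antitone_cantorLevel
      ⟨0, (isCompact_cantorLevel 0).measure_lt_top.ne⟩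
  have h2 : Tendsto (fun k => volume (cantorLevel k)) atTop (𝓝 (ENNReal.ofReal (1 / 2))) := by
    simp only [volume_cantorLevel]
    refine ENNReal.tendsto_ofReal ?_
    have := ((tendsto_pow_atTop_nhds_zero_of_lt_one (r := (1 / 2 : ℝ)) (by norm_num)
      (by norm_num)).div_const 4).const_add (1 / 2)
    simpa using this
  rw [tendsto_nhds_unique h1 h2, ENNReal.ofReal_div_of_pos (by norm_num)]
  simp

/-- The midpoint of the interval of generation `k` with binary address `b`. -/
noncomputable def cantorCenter (b : ℕ → Bool) : ℕ → ℝ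
  | 0 => 1 / 2
  | k + 1 => if b k then cantorCenter b k + cantorRadius k / 2
      else cantorCenter b k - cantorRadius k / 2

theorem cantorCenter_mem (b : ℕ → Bool) (k : ℕ) : cantorCenter b k ∈ cantorCenters k := by
  induction k with
  | zero => simp [cantorCenter, cantorCenters]
  | succ k ih =>
    refine mem_cantorCenters_succ.2 ⟨_, ih, ?_⟩
    cases h : b k <;> simp [cantorCenter, h]

theorem continuous_cantorCenter (k : ℕ) : Continuous fun b => cantorCenter b k := by
  induction k with
  | zero => exact continuous_const
  | succ k ih =>
    have : Continuous fun b : ℕ → Bool => if b k then cantorRadius k / 2 else -(cantorRadius k / 2) :=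
      (continuous_of_discreteTopology (f := fun c : Bool =>
        if c then cantorRadius k / 2 else -(cantorRadius k / 2))).comp (continuous_apply k)
    convert! ih.add this using 1
    ext b
    cases h : b k <;> simp [cantorCenter, h, sub_eq_add_neg]

theorem exists_mem_cantor_address (b : ℕ → Bool) :
    ∃ x, ∀ k, |x - cantorCenter b k| ≤ cantorRadius k := by
  have h := IsCompact.nonempty_iInter_of_sequence_nonempty_isCompact_isClosed
    (fun k => Metric.closedBall (cantorCenter b k) (cantorRadius k))
    (fun k => by
      have h1 := cantorRadius_succ_lt k
      refine Metric.closedBall_subset_closedBall' ?_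
      rw [Real.dist_eq]
      have : |cantorCenter b (k + 1) - cantorCenter b k| = cantorRadius k / 2 := by
        have h0 := cantorRadius_pos k
        cases hb : b k <;> simp [cantorCenter, hb] <;> linarith
      linarith)
    (fun k => Metric.nonempty_closedBall.2 (cantorRadius_pos k).le)
    (isCompact_closedBall _ _) (fun k => Metric.isClosed_closedBall)
  obtain ⟨x, hx⟩ := h
  exact ⟨x, fun k => by simpa [Real.dist_eq] using mem_iInter.1 hx k⟩

/-- The address map is a uniform limit of the locally constant maps `cantorCenter · k`, hence
continuous. Being bijective from a compact space to a Hausdorff one, it is a homeomorphism. -/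
theorem nonempty_homeomorph_fatCantor : Nonempty ((ℕ → Bool) ≃ₜ fatCantor) := by
  choose φ hφ using exists_mem_cantor_address
  have hmem : ∀ b, φ b ∈ fatCantor := fun b =>
    mem_iInter.2 fun k => mem_cantorLevel.2 ⟨_, cantorCenter_mem b k, hφ b k⟩
  have hcont : Continuous φ := by
    refine TendstoUniformly.continuous (F := fun k b => cantorCenter b k) (p := atTop) ?_
      (Frequently.of_forall continuous_cantorCenter)
    rw [Metric.tendstoUniformly_iff]
    intro ε hε
    filter_upwards [tendsto_cantorRadius.eventually_lt_const hε] with k hk b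
    rw [Real.dist_eq]
    exact (hφ b k).trans_lt hk
  have hinj : Function.Injective φ := by
    intro b b' hbb
    have h1 : ∀ k, cantorCenter b k = cantorCenter b' k := fun k =>
      cantorCenters_unique (cantorCenter_mem b k) (cantorCenter_mem b' k) (hφ b k)
        (hbb ▸ hφ b' k)
    funext k
    have h2 := h1 (k + 1)
    have h3 := h1 k
    have h0 := cantorRadius_pos k
    cases hb : b k <;> cases hb' : b' k <;> simp [cantorCenter, hb, hb'] at h2 ⊢ <;> linarith
  have hsurj : ∀ x ∈ fatCantor, ∃ b, φ b = x := by
    classical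
    intro x hx
    -- Bit `k` records whether `x` lies to the right of the midpoint of its interval of generation
    -- `k`; `x` is never that midpoint, since it lies in one of the children.
    let b : ℕ → Bool := fun k => decide (∃ z ∈ cantorCenters k, |x - z| ≤ cantorRadius k ∧ z < x)
    have hb : ∀ k, |x - cantorCenter b k| ≤ cantorRadius k := by
      intro k
      induction k with
      | zero =>
        obtain ⟨z, hz, hxz⟩ := mem_cantorLevel.1 (mem_iInter.1 hx 0)
        simp only [cantorCenters, Finset.mem_singleton] at hz
        rw [hz] at hxz
        exact hxz
      | succ k ih =>
        obtain ⟨z, hz, hxz⟩ := mem_cantorLevel.1 (mem_iInter.1 hx (k + 1))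
        obtain ⟨u, hu, hzu⟩ := mem_cantorCenters_succ.1 hz
        have h0 := cantorRadius_pos k
        have h1 := cantorRadius_succ_lt k
        have hxz' := abs_le.1 hxz
        have hxu : |x - u| ≤ cantorRadius k := by
          rw [abs_le]; rcases hzu with rfl | rfl <;> constructor <;> linarith
        have hu' := cantorCenters_unique hu (cantorCenter_mem b k) hxu ih
        rcases hzu with rfl | rfl
        · have hbk : b k = true := decide_eq_true ⟨u, hu, hxu, by linarith⟩
          rw [cantorCenter, hbk, if_pos rfl, ← hu']; exact hxz
        · have hbk : b k = false := by
            refine decide_eq_false ?_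
            rintro ⟨v, hv, hxv, hvx⟩
            have := cantorCenters_unique hu hv hxu hxv
            subst this
            linarith
          rw [cantorCenter, hbk, if_neg (by simp), ← hu']; exact hxz
    refine ⟨b, eq_of_abs_sub_eq_zero (le_antisymm ?_ (abs_nonneg _))⟩
    have h2 : Tendsto (fun k => cantorRadius k + cantorRadius k) atTop (𝓝 0) := by
      simpa using tendsto_cantorRadius.add tendsto_cantorRadius
    refine ge_of_tendsto' h2 fun k => ?_
    have h3 := abs_sub_le (φ b) (cantorCenter b k) x
    rw [abs_sub_comm (cantorCenter b k) x] at h3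
    linarith [hφ b k, hb k]
  let e : (ℕ → Bool) ≃ fatCantor := Equiv.ofBijective (fun b => ⟨φ b, hmem b⟩)
    ⟨fun b b' h => hinj (congrArg Subtype.val h), fun x => by
      obtain ⟨b, hb⟩ := hsurj x x.2
      exact ⟨b, Subtype.ext hb⟩⟩
  exact ⟨Continuous.homeoOfEquivCompactToT2 (f := e) (hcont.subtype_mk hmem)⟩

/-! ### The Cantor dust -/

/-- The `n`-fold power of the fat Cantor set. -/
def cantorDust (n : ℕ) : Set (EuclideanSpace ℝ (Fin n)) := {x | ∀ i, x i ∈ fatCantor}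

theorem volume_cantorDust (n : ℕ) : volume (cantorDust n) = (1 / 2 : ℝ≥0∞) ^ n := by
  have h : cantorDust n = WithLp.ofLp ⁻¹' (Set.univ.pi fun _ => fatCantor) := by
    ext x; simp [cantorDust]
  rw [h, (PiLp.volume_preserving_ofLp (Fin n)).measure_preimage
    (MeasurableSet.univ_pi fun _ => isCompact_fatCantor.measurableSet).nullMeasurableSet,
    volume_pi_pi]
  simp [volume_fatCantor]

theorem isCompact_cantorDust (n : ℕ) : IsCompact (cantorDust n) := by
  have h : cantorDust n = (EuclideanSpace.equiv (Fin n) ℝ).symm.toHomeomorph ''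
      (Set.univ.pi fun _ => fatCantor) := by
    rw [Homeomorph.image_eq_preimage_symm]
    ext x; simp [cantorDust]
  rw [h]
  exact (isCompact_univ_pi fun _ => isCompact_fatCantor).image (Homeomorph.continuous _)

theorem nonempty_homeomorph_cantorDust {n : ℕ} (hn : 0 < n) :
    Nonempty (cantorDust n ≃ₜ cantorSet) := by
  obtain ⟨e⟩ := nonempty_homeomorph_fatCantor
  have : Nonempty (Fin n) := ⟨⟨0, hn⟩⟩
  let e1 : cantorDust n ≃ₜ (Fin n → fatCantor) :=
    { toFun := fun x i => ⟨x.1 i, x.2 i⟩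
      invFun := fun y => ⟨WithLp.toLp 2 fun i => (y i : ℝ), fun i => (y i).2⟩
      left_inv := fun x => rfl
      right_inv := fun y => rfl
      continuous_toFun := by fun_prop
      continuous_invFun := by fun_prop }
  let e2 : (Fin n → fatCantor) ≃ₜ (Fin n → ℕ → Bool) := Homeomorph.piCongrRight fun _ => e.symm
  let e3 : (Fin n → ℕ → Bool) ≃ₜ (Fin n × ℕ → Bool) :=
    { toFun := fun f p => f p.1 p.2
      invFun := fun f i j => f (i, j)
      left_inv := fun x => rfl
      right_inv := fun y => rfl
      continuous_toFun := by fun_prop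
      continuous_invFun := by fun_prop }
  obtain ⟨t⟩ : Nonempty (Fin n × ℕ ≃ ℕ) := nonempty_equiv_of_countable
  let e4 : (Fin n × ℕ → Bool) ≃ₜ (ℕ → Bool) := Homeomorph.piCongrLeft (Y := fun _ => Bool) t
  exact ⟨(((e1.trans e2).trans e3).trans e4).trans cantorSetHomeomorphNatToBool.symm⟩

/-! ### The limit homeomorphism -/

/-- The inverses must be controlled too: a uniform limit of homeomorphisms need not be injective.
With both limits continuous, the identities `P k ∘ (P k).symm = id` and its mirror pass to the
limit. -/
theorem exists_homeomorph_of_geometric {E : Type*} [MetricSpace E] [CompleteSpace E]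
    (P : ℕ → Equiv.Perm E) (hP : ∀ k, Continuous (P k)) (hP' : ∀ k, Continuous (P k).symm) (C : ℝ)
    (h : ∀ k x, dist (P k x) (P (k + 1) x) ≤ C * (1 / 2) ^ k)
    (h' : ∀ k x, dist ((P k).symm x) ((P (k + 1)).symm x) ≤ C * (1 / 2) ^ k) :
    ∃ F : E ≃ₜ E, TendstoUniformly (fun k => P k) F atTop ∧
      TendstoUniformly (fun k => (P k).symm) F.symm atTop := by
  have key : ∀ Q : ℕ → Equiv.Perm E, (∀ k x, dist (Q k x) (Q (k + 1) x) ≤ C * (1 / 2) ^ k) →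
      ∃ f : E → E, TendstoUniformly (fun k => Q k) f atTop := by
    intro Q hQ
    have hc : ∀ x, ∃ y, Tendsto (fun k => Q k x) atTop (𝓝 y) := fun x =>
      cauchySeq_tendsto_of_complete
        (cauchySeq_of_le_geometric (1 / 2) C (by norm_num) fun k => hQ k x)
    choose f hf using hc
    refine ⟨f, Metric.tendstoUniformly_iff.2 fun ε hε => ?_⟩
    have h0 : Tendsto (fun k : ℕ => C * (1 / 2 : ℝ) ^ k / (1 - 1 / 2)) atTop (𝓝 0) := by
      simpa using ((tendsto_pow_atTop_nhds_zero_of_lt_one (r := (1 / 2 : ℝ)) (by norm_num)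
        (by norm_num)).const_mul C).div_const (1 - 1 / 2)
    filter_upwards [h0.eventually_lt_const hε] with k hk x
    rw [dist_comm]
    exact (dist_le_of_le_geometric_of_tendsto (1 / 2) C (by norm_num) (fun k => hQ k x) (hf x)
      k).trans_lt hk
  obtain ⟨f, hf⟩ := key P h
  obtain ⟨g, hg⟩ := key (fun k => (P k).symm) h'
  have hfc : Continuous f := hf.continuous (Frequently.of_forall hP)
  have hgc : Continuous g := hg.continuous (Frequently.of_forall hP')
  refine ⟨⟨⟨f, g, fun x => ?_, fun x => ?_⟩, hfc, hgc⟩, hf, hg⟩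
  · have := hg.tendsto_comp hgc.continuousAt (hf.tendsto_at x)
    simp only [Equiv.symm_apply_apply] at this
    exact tendsto_nhds_unique this tendsto_const_nhds
  · have := hf.tendsto_comp hfc.continuousAt (hg.tendsto_at x)
    simp only [Equiv.apply_symm_apply] at this
    exact tendsto_nhds_unique this tendsto_const_nhds

/-- The union of the cubes of generation `k` of the Cantor dust. -/
def cubeLevel (n k : ℕ) : Set (EuclideanSpace ℝ (Fin n)) := {x | ∀ i, x i ∈ cantorLevel k}

/-- The set of centres of the cubes of generation `k` of the Cantor dust. -/
noncomputable def cubeCenters (n k : ℕ) : Finset (EuclideanSpace ℝ (Fin n)) :=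
  (Fintype.piFinset fun _ => cantorCenters k).map (WithLp.equiv 2 (Fin n → ℝ)).symm.toEmbedding

theorem mem_cubeCenters {n k : ℕ} {c : EuclideanSpace ℝ (Fin n)} :
    c ∈ cubeCenters n k ↔ ∀ i, c i ∈ cantorCenters k := by
  simp only [cubeCenters, Finset.mem_map_equiv, Equiv.symm_symm, Fintype.mem_piFinset]
  rfl

theorem mem_cubeLevel {n k : ℕ} {x : EuclideanSpace ℝ (Fin n)} :
    x ∈ cubeLevel n k ↔ ∃ c ∈ cubeCenters n k, ∀ i, |x i - c i| ≤ cantorRadius k := by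
  simp only [cubeLevel, mem_ofPred_eq, mem_cantorLevel, mem_cubeCenters]
  constructor
  · intro h
    choose c hc hx using h
    exact ⟨WithLp.toLp 2 c, hc, hx⟩
  · rintro ⟨c, hc, hx⟩ i
    exact ⟨c i, hc i, hx i⟩

theorem antitone_cubeLevel (n : ℕ) : Antitone (cubeLevel n) := fun _ _ h _ hx i =>
  antitone_cantorLevel h (hx i)

theorem isClosed_cubeLevel (n k : ℕ) : IsClosed (cubeLevel n k) := by
  simp only [cubeLevel, ofPred_forall]
  exact isClosed_iInter fun i => (isCompact_cantorLevel k).isClosed.preimage (by fun_prop)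

theorem cantorDust_eq_iInter (n : ℕ) : cantorDust n = ⋂ k, cubeLevel n k := by
  ext x
  simp only [cantorDust, fatCantor, cubeLevel, mem_iInter, mem_ofPred_eq]
  exact forall_comm

/-- Exchanging the upper and the lower children of all the cubes of generation `k`. -/
theorem exists_swap_children {n : ℕ} {j l : Fin n} (hjl : j ≠ l) (k : ℕ) :
    ∃ G : Equiv.Perm (EuclideanSpace ℝ (Fin n)), IsSmoothPerm G ∧
      (∀ x ∉ cubeLevel n k, G x = x) ∧
      (∀ c ∈ cubeCenters n k, ∀ x, (∀ i, |x i - c i| ≤ cantorRadius k) →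
        ∀ i, |G x i - c i| ≤ cantorRadius k) ∧
      ∀ c ∈ cubeCenters n (k + 1), ∃ u ∈ cubeCenters n k,
        ∀ x, (∀ i, |x i - c i| ≤ cantorRadius (k + 1)) → (∀ i, |x i - u i| ≤ cantorRadius k) ∧
          G x = x + EuclideanSpace.single l (2 * (u l - c l)) := by
  have hr := cantorRadius_pos k
  have hs := cantorRadius_pos (k + 1)
  have hsr := cantorRadius_succ_lt k
  obtain ⟨S, hS, hSo, hSi⟩ := exists_swap_slabs hjl hs hsr
  set B : Set (EuclideanSpace ℝ (Fin n)) := {x | ∀ i, |x i| ≤ cantorRadius k} with hB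
  have hSB : ∀ x ∉ B, S x = x := fun x hx => hSo x (by simpa [hB] using hx)
  have hSB' : ∀ x ∈ B, S x ∈ B := fun x hx => by
    by_contra h
    exact h (by rw [S.injective (hSB _ h)]; exact hx)
  obtain ⟨G, hG, hGi, hGo⟩ := exists_glue (cubeCenters n k) (B := B) (by
    intro z hz z' hz' x hx hx'
    ext i
    exact cantorCenters_unique (mem_cubeCenters.1 hz i) (mem_cubeCenters.1 hz' i) (hx i) (hx' i))
    hS hSB
  refine ⟨G, hG, fun x hx => hGo x fun z hz h => hx (mem_cubeLevel.2 ⟨z, hz, h⟩), ?_, ?_⟩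
  · intro c hc x hx i
    rw [hGi c hc x hx]
    simpa using hSB' (x - c) hx i
  · intro c hc
    have h1 : ∀ i, ∃ u ∈ cantorCenters k, c i = u + cantorRadius k / 2 ∨
      c i = u - cantorRadius k / 2 := fun i => mem_cantorCenters_succ.1 (mem_cubeCenters.1 hc i)
    choose u hu hcu using h1
    have hu' : WithLp.toLp 2 u ∈ cubeCenters n k := mem_cubeCenters.2 hu
    refine ⟨WithLp.toLp 2 u, hu', fun x hx => ?_⟩
    have hxu : ∀ i, |x i - u i| ≤ cantorRadius k / 2 + cantorRadius (k + 1) := by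
      intro i
      have h2 := abs_le.1 (hx i)
      rw [abs_le]
      rcases hcu i with h | h <;> constructor <;> linarith
    have hxB : x - WithLp.toLp 2 u ∈ B := fun i => by
      have := hxu i
      simp only [PiLp.sub_apply]
      linarith
    refine ⟨hxB, ?_⟩
    rw [hGi _ hu' x hxB]
    simp only
    -- An upper child has `2 * (u l - c l) = -cantorRadius k`, a lower one the opposite: the shift
    -- between the slab centres `±cantorRadius k / 2`.
    rcases hcu l with h | h
    · set w : EuclideanSpace ℝ (Fin n) := x - WithLp.toLp 2 u -
        EuclideanSpace.single l (cantorRadius k / 2) with hw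
      have h3 := (hSi w (fun i hi => by simpa [hw, hi] using hxu i) (by
        have := hx l
        rw [h] at this
        simpa [hw, sub_sub] using this)).1
      rw [show EuclideanSpace.single l (cantorRadius k / 2) + w = x - WithLp.toLp 2 u by
        rw [hw]; abel] at h3
      rw [h3, h, hw]
      ext i
      by_cases hi : i = l
      · subst hi; simp; ring
      · simp [hi]
    · set w : EuclideanSpace ℝ (Fin n) := x - WithLp.toLp 2 u -
        EuclideanSpace.single l (-(cantorRadius k / 2)) with hw
      have h3 := (hSi w (fun i hi => by simpa [hw, hi] using hxu i) (by
        have := hx l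
        rw [h] at this
        convert this using 2
        simp [hw]; ring)).2
      rw [show EuclideanSpace.single l (-(cantorRadius k / 2)) + w = x - WithLp.toLp 2 u by
        rw [hw]; abel] at h3
      rw [h3, h, hw]
      ext i
      by_cases hi : i = l
      · subst hi; simp; ring
      · simp [hi]

theorem exists_reflecting_homeomorph {n : ℕ} {j l : Fin n} (hjl : j ≠ l) :
    ∃ (P : ℕ → Equiv.Perm (EuclideanSpace ℝ (Fin n)))
      (F : EuclideanSpace ℝ (Fin n) ≃ₜ EuclideanSpace ℝ (Fin n)),
      (∀ k, IsSmoothPerm (P k)) ∧ TendstoUniformly (fun k => P k) F atTop ∧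
      TendstoUniformly (fun k => (P k).symm) F.symm atTop ∧
      (∀ k, ∀ x ∉ cubeLevel n 0, P k x = x) ∧ (∀ k, ∀ x ∉ cubeLevel n k, F x = P k x) ∧
      ∀ x ∈ cantorDust n, F x = x + EuclideanSpace.single l (1 - 2 * x l) := by
  choose G hG hGo hGc hGi using fun k => exists_swap_children hjl k
  let P : ℕ → Equiv.Perm (EuclideanSpace ℝ (Fin n)) := fun k =>
    Nat.rec (Equiv.refl _) (fun k p => (G k).trans p) k
  have hP0 : ∀ x, P 0 x = x := fun x => rfl
  have hPs : ∀ k x, P (k + 1) x = P k (G k x) := fun k x => rfl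
  have hPs' : ∀ k x, (P (k + 1)).symm x = (G k).symm ((P k).symm x) := fun k x => rfl
  have hsm : ∀ k, IsSmoothPerm (P k) := by
    intro k
    induction k with
    | zero => exact IsSmoothPerm.refl
    | succ k ih => exact (hG k).trans ih
  -- On a cube with centre `c`, `P k` is the translation taking `c` to its mirror image. In the
  -- induction `G k` acts first and stays inside the parent cube, where `P k` is already a
  -- translation; the shifts `2 * (u l - c l)` and `1 - 2 * u l` add up.
  have hcube : ∀ k, ∀ c ∈ cubeCenters n k, ∀ x, (∀ i, |x i - c i| ≤ cantorRadius k) →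
      P k x = x + EuclideanSpace.single l (1 - 2 * c l) := by
    intro k
    induction k with
    | zero =>
      intro c hc x hx
      have : c l = 1 / 2 := by simpa [cantorCenters] using mem_cubeCenters.1 hc l
      rw [hP0, this]; norm_num
    | succ k ih =>
      intro c hc x hx
      obtain ⟨u, hu, h⟩ := hGi k c hc
      obtain ⟨h1, h2⟩ := h x hx
      rw [hPs, ih u hu _ (hGc k u hu x h1), h2, add_assoc]
      congr 1
      ext i
      by_cases hi : i = l
      · subst hi; simp; ring
      · simp [hi]
  have hGd : ∀ k x, ‖G k x - x‖ ≤ n * (2 * cantorRadius k) := by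
    intro k x
    by_cases hx : x ∈ cubeLevel n k
    · obtain ⟨c, hc, hxc⟩ := mem_cubeLevel.1 hx
      have h := EuclideanSpace.norm_le_card_mul (w := G k x - x) (r := 2 * cantorRadius k)
        fun i => by
          have h1 := abs_le.1 (hxc i)
          have h2 := abs_le.1 (hGc k c hc x hxc i)
          rw [PiLp.sub_apply, abs_le]
          constructor <;> linarith
      rwa [Fintype.card_fin] at h
    · rw [hGo k x hx, sub_self, norm_zero]
      have := cantorRadius_pos k
      positivity
  have hgeo : ∀ k, n * (2 * cantorRadius k) ≤ (n : ℝ) * (1 / 2) ^ k := by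
    intro k
    gcongr
    have : (1 / 4 : ℝ) ^ k ≤ (1 / 2) ^ k := by gcongr; norm_num
    unfold cantorRadius
    have : (0 : ℝ) < (1 / 2) ^ k := by positivity
    linarith
  obtain ⟨F, hF, hF'⟩ := exists_homeomorph_of_geometric P (fun k => (hsm k).1.continuous)
    (fun k => (hsm k).2.continuous) n (by
      intro k x
      refine le_trans ?_ (hgeo k)
      rw [hPs, dist_comm, dist_eq_norm]
      by_cases hx : x ∈ cubeLevel n k
      · obtain ⟨c, hc, hxc⟩ := mem_cubeLevel.1 hx
        -- Both `x` and `G k x` lie in the cube, where `P k` is a translation and so preserves their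
        -- distance; no Lipschitz bound on `P k` is needed.
        rw [hcube k c hc x hxc, hcube k c hc _ (hGc k c hc x hxc), add_sub_add_right_eq_sub]
        exact hGd k x
      · rw [hGo k x hx, sub_self, norm_zero]
        have := cantorRadius_pos k
        positivity)
    (by
      intro k x
      refine le_trans ?_ (hgeo k)
      have h := hGd k ((G k).symm ((P k).symm x))
      rw [(G k).apply_symm_apply] at h
      rw [hPs', dist_eq_norm]
      exact h)
  refine ⟨P, F, hsm, hF, hF', ?_, ?_, ?_⟩
  · intro k x hx
    induction k with
    | zero => rfl
    | succ k ih => rw [hPs, hGo k x fun h => hx (antitone_cubeLevel n (Nat.zero_le _) h), ih]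
  · intro k x hx
    have h1 : ∀ m ≥ k, P m x = P k x := by
      intro m hm
      induction m, hm using Nat.le_induction with
      | base => rfl
      | succ m hm ih => rw [hPs, hGo m x fun h => hx (antitone_cubeLevel n hm h), ih]
    refine tendsto_nhds_unique (hF.tendsto_at x) (tendsto_const_nhds.congr' ?_)
    filter_upwards [eventually_ge_atTop k] with m hm using (h1 m hm).symm
  · intro x hx
    refine tendsto_nhds_unique (hF.tendsto_at x) ?_
    rw [tendsto_iff_dist_tendsto_zero]
    have h2 : Tendsto (fun k => 2 * cantorRadius k) atTop (𝓝 0) := by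
      simpa using tendsto_cantorRadius.const_mul 2
    refine squeeze_zero (fun _ => dist_nonneg) (fun k => ?_) h2
    -- The cubes around `x` have centres converging to `x`, so the translations by `1 - 2 * c l`
    -- converge to the reflection at `x`.
    rw [cantorDust_eq_iInter] at hx
    obtain ⟨c, hc, hxc⟩ := mem_cubeLevel.1 (mem_iInter.1 hx k)
    rw [hcube k c hc x hxc, dist_add_left, dist_eq_norm]
    rw [show (EuclideanSpace.single l (1 - 2 * c l) : EuclideanSpace ℝ (Fin n))
      - EuclideanSpace.single l (1 - 2 * x l) = EuclideanSpace.single l (2 * (x l - c l)) by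
        ext i
        by_cases hi : i = l
        · subst hi; simp; ring
        · simp [hi], PiLp.norm_single, Real.norm_eq_abs, abs_mul, abs_two]
    linarith [hxc l]

/-! ### Density points and approximate derivatives -/

theorem isDensityPoint_of_mem_interior {n : ℕ} {S : Set (EuclideanSpace ℝ (Fin n))}
    {x : EuclideanSpace ℝ (Fin n)} (hx : x ∈ interior S) : IsDensityPoint S x := by
  obtain ⟨δ, hδ, hS⟩ := Metric.mem_nhds_iff.1 (mem_interior_iff_mem_nhds.1 hx)
  refine tendsto_const_nhds.congr' ?_
  filter_upwards [Ioo_mem_nhdsGT hδ] with ρ hρ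
  rw [inter_eq_self_of_subset_right ((Metric.ball_subset_ball hρ.2.le).trans hS), ENNReal.div_self]
  · exact (Metric.measure_ball_pos _ _ hρ.1).ne'
  · exact measure_ball_lt_top.ne

/-- Lebesgue's density theorem for closed balls, transferred to open balls because spheres are null.
-/
theorem ae_isDensityPoint {n : ℕ} (S : Set (EuclideanSpace ℝ (Fin n))) :
    ∀ᵐ x ∂(volume.restrict S), IsDensityPoint S x := by
  filter_upwards [Besicovitch.ae_tendsto_measure_inter_div volume S] with x hx
  refine hx.congr' ?_
  filter_upwards [self_mem_nhdsWithin] with ρ hρ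
  have h0 : volume (Metric.sphere x ρ) = 0 := Measure.addHaar_sphere_of_ne_zero _ x (ne_of_gt hρ)
  have h1 : ∀ T : Set (EuclideanSpace ℝ (Fin n)),
      volume (T ∩ Metric.closedBall x ρ) = volume (T ∩ Metric.ball x ρ) := by
    intro T
    refine le_antisymm ?_ (measure_mono (inter_subset_inter_right _ Metric.ball_subset_closedBall))
    rw [← Metric.ball_union_sphere, inter_union_distrib_left]
    refine (measure_union_le _ _).trans ?_
    rw [measure_mono_null inter_subset_right h0, add_zero]
  have h2 := h1 univ
  rw [univ_inter, univ_inter] at h2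
  rw [h1, h2]

theorem HasFDerivAt.hasApproxFDeriv {n : ℕ} {S : Set (EuclideanSpace ℝ (Fin n))}
    (hS : MeasurableSet S) {f : EuclideanSpace ℝ (Fin n) → EuclideanSpace ℝ (Fin n)}
    {L : EuclideanSpace ℝ (Fin n) →L[ℝ] EuclideanSpace ℝ (Fin n)} {x : EuclideanSpace ℝ (Fin n)}
    (hx : x ∈ interior S) (hf : HasFDerivAt f L x) : HasApproxFDeriv S f L x := by
  intro i
  refine ⟨interior_subset hx, S, Subset.rfl, hS.nullMeasurableSet,
    isDensityPoint_of_mem_interior hx, ?_⟩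
  have h1 := ((EuclideanSpace.proj i : EuclideanSpace ℝ (Fin n) →L[ℝ] ℝ).hasFDerivAt
    (x := f x)).comp x hf
  refine ((hasFDerivAt_iff_tendsto.1 h1).mono_left nhdsWithin_le_nhds).congr fun y => ?_
  rw [div_eq_inv_mul]
  rfl

theorem hasApproxFDeriv_of_affine_on {n : ℕ} {S A : Set (EuclideanSpace ℝ (Fin n))} (hAS : A ⊆ S)
    (hA : MeasurableSet A) {f : EuclideanSpace ℝ (Fin n) → EuclideanSpace ℝ (Fin n)}
    {L : EuclideanSpace ℝ (Fin n) →L[ℝ] EuclideanSpace ℝ (Fin n)} {x : EuclideanSpace ℝ (Fin n)}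
    (hx : x ∈ A) (hd : IsDensityPoint A x) (hf : ∀ y ∈ A, f y - f x = L (y - x)) :
    HasApproxFDeriv S f L x := by
  intro i
  refine ⟨hAS hx, A, hAS, hA.nullMeasurableSet, hd, tendsto_const_nhds.congr' ?_⟩
  filter_upwards [self_mem_nhdsWithin] with y hy
  have h1 : f y i - f x i = L (y - x) i := by rw [← hf y hy.1]; rfl
  simp [h1]

/-! ### The reflection -/

theorem reflectLast_eq {n : ℕ} {l : Fin n} (hl : (l : ℕ) + 1 = n) (x : EuclideanSpace ℝ (Fin n)) :
    reflectLast x = x + EuclideanSpace.single l (1 - 2 * x l) := by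
  ext i
  by_cases hi : i = l
  · subst hi; simp [reflectLast, hl]; ring
  · have : (i : ℕ) + 1 ≠ n := fun h => hi (Fin.ext (by omega))
    simp [reflectLast, hi, this]

theorem reflectLast_reflectLast {n : ℕ} (x : EuclideanSpace ℝ (Fin n)) :
    reflectLast (reflectLast x) = x := by
  ext i
  by_cases h : (i : ℕ) + 1 = n <;> simp [reflectLast, h]

theorem reflectLast_sub {n : ℕ} (x y : EuclideanSpace ℝ (Fin n)) :
    reflectLast y - reflectLast x = diagLast n (y - x) := by
  ext i
  have h : (diagLast n (y - x)) i =
      (if (i : ℕ) + 1 = n then (-1 : ℝ) else 1) * (y i - x i) := by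
    simp [diagLast, Matrix.ofLp_toEuclideanCLM, Matrix.mulVec_diagonal]
    split_ifs <;> ring
  rw [h]
  by_cases h : (i : ℕ) + 1 = n <;> simp [reflectLast, h]

theorem differentiable_reflectLast {n : ℕ} :
    Differentiable ℝ (reflectLast : EuclideanSpace ℝ (Fin n) → EuclideanSpace ℝ (Fin n)) := by
  intro x
  refine ((diagLast n).differentiable.comp (differentiable_id.sub_const x)).add_const
    (reflectLast x) |>.differentiableAt.congr_of_eventuallyEq (Eventually.of_forall fun y => ?_)
  simp [← reflectLast_sub]

theorem det_diagLast {n : ℕ} (hn : 0 < n) : (diagLast n).det = -1 := by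
  have h : (diagLast n).det = (Matrix.diagonal fun i : Fin n =>
      if (i : ℕ) + 1 = n then (-1 : ℝ) else 1).det := by
    rw [ContinuousLinearMap.det, diagLast, Matrix.coe_toEuclideanCLM_eq_toEuclideanLin,
      Matrix.toEuclideanLin, Matrix.toLpLin_eq_toLin, LinearMap.det_toLin]
  rw [h, Matrix.det_diagonal]
  have h2 : ∀ i : Fin n, ((i : ℕ) + 1 = n) ↔ i = ⟨n - 1, by omega⟩ := by
    intro i; rw [Fin.ext_iff]; simp only; omega
  simp [h2]

theorem reflectLast_mem_cantorDust {n : ℕ} {x : EuclideanSpace ℝ (Fin n)} (hx : x ∈ cantorDust n) :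
    reflectLast x ∈ cantorDust n := by
  intro i
  by_cases h : (i : ℕ) + 1 = n
  · simpa [reflectLast, h] using one_sub_mem_fatCantor (hx i)
  · simpa [reflectLast, h] using hx i

/-! ### The unit cube and restriction to it -/

theorem isClosed_unitCube (n : ℕ) : IsClosed (unitCube n) := by
  simp only [unitCube, ofPred_forall]
  exact isClosed_iInter fun i => isClosed_Icc.preimage (by fun_prop)

theorem convex_unitCube (n : ℕ) : Convex ℝ (unitCube n) := by
  intro x hx y hy a b ha hb hab i
  exact convex_Icc (0 : ℝ) 1 (hx i) (hy i) ha hb hab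

theorem mem_interior_unitCube {n : ℕ} {x : EuclideanSpace ℝ (Fin n)}
    (hx : ∀ i, x i ∈ Ioo (0 : ℝ) 1) : x ∈ interior (unitCube n) := by
  have ho : IsOpen {x : EuclideanSpace ℝ (Fin n) | ∀ i, x i ∈ Ioo (0 : ℝ) 1} := by
    simp only [ofPred_forall]
    exact isOpen_iInter_of_finite fun i => isOpen_Ioo.preimage (by fun_prop)
  exact interior_maximal (t := {x : EuclideanSpace ℝ (Fin n) | ∀ i, x i ∈ Ioo (0 : ℝ) 1})
    (fun y hy i => Ioo_subset_Icc_self (hy i)) ho hx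

theorem mem_cantorLevel_zero {x : ℝ} : x ∈ cantorLevel 0 ↔ |x - 1 / 2| ≤ 3 / 8 := by
  rw [mem_cantorLevel]
  simp only [cantorCenters, Finset.mem_singleton, exists_eq_left, cantorRadius]
  norm_num

theorem cubeLevel_zero_subset_interior (n : ℕ) : cubeLevel n 0 ⊆ interior (unitCube n) := by
  intro x hx
  refine mem_interior_unitCube fun i => ?_
  have := abs_le.1 (mem_cantorLevel_zero.1 (hx i))
  constructor <;> linarith

theorem cantorDust_subset_cubeLevel (n k : ℕ) : cantorDust n ⊆ cubeLevel n k := by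
  rw [cantorDust_eq_iInter]; exact iInter_subset _ k

/-- The restriction to the unit cube of a homeomorphism that is the identity off it. -/
def restrictUnitCube {n : ℕ} (F : EuclideanSpace ℝ (Fin n) ≃ₜ EuclideanSpace ℝ (Fin n))
    (hF : ∀ x ∉ unitCube n, F x = x) : unitCube n ≃ₜ unitCube n :=
  F.subtype fun x => by
    constructor
    · intro hx
      by_contra h
      exact h (by rw [F.injective (hF _ h)]; exact hx)
    · intro hx
      by_contra h
      exact h (by rw [hF x h] at hx; exact hx)

theorem extendById_restrictUnitCube {n : ℕ}
    (F : EuclideanSpace ℝ (Fin n) ≃ₜ EuclideanSpace ℝ (Fin n)) (hF : ∀ x ∉ unitCube n, F x = x) :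
    extendById (restrictUnitCube F hF) = F := by
  ext x : 1
  by_cases h : x ∈ unitCube n
  · simp only [extendById, dif_pos h]; rfl
  · simp only [extendById, dif_neg h]; exact (hF x h).symm

theorem extendById_restrictUnitCube_symm {n : ℕ}
    (F : EuclideanSpace ℝ (Fin n) ≃ₜ EuclideanSpace ℝ (Fin n)) (hF : ∀ x ∉ unitCube n, F x = x) :
    extendById (restrictUnitCube F hF).symm = F.symm := by
  ext x : 1
  by_cases h : x ∈ unitCube n
  · simp only [extendById, dif_pos h]; rfl
  · simp only [extendById, dif_neg h]
    rw [Homeomorph.eq_symm_apply, hF x h]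

/-! ### The local degree -/

/-- For large `k`, `P k` is an admissible smooth approximation. Its fibre over `F x` is the single
point `(P k).symm (F x)`, which lies in the ball because the inverses converge uniformly as well; it
contributes `+1`. -/
theorem isBrouwerDegree_one_of_tendstoUniformly {n : ℕ} (hn : 0 < n)
    (F : EuclideanSpace ℝ (Fin n) ≃ₜ EuclideanSpace ℝ (Fin n))
    {P : ℕ → Equiv.Perm (EuclideanSpace ℝ (Fin n))} (hP : ∀ k, IsSmoothPerm (P k))
    (hdet : ∀ k x, 0 < (fderiv ℝ (P k) x).det) (hF : TendstoUniformly (fun k => P k) F atTop)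
    (hF' : TendstoUniformly (fun k => (P k).symm) F.symm atTop) (x : EuclideanSpace ℝ (Fin n))
    {r : ℝ} (hr : 0 < r) : IsBrouwerDegree F (Metric.ball x r) (F x) 1 := by
  have : Nonempty (Fin n) := ⟨⟨0, hn⟩⟩
  have hfr : frontier (Metric.ball x r) = Metric.sphere x r := frontier_ball x hr.ne'
  have hnot : F x ∉ F '' frontier (Metric.ball x r) := by
    rw [hfr]
    rintro ⟨y, hy, hxy⟩
    rw [F.injective hxy] at hy
    simp [hr.ne] at hy
  have hclosed : IsClosed (F '' frontier (Metric.ball x r)) := F.isClosedMap _ isClosed_frontier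
  -- This uses `0 < n`: in dimension `0` the sphere is empty, `Metric.infDist` takes the default
  -- value `0`, and no map is strictly closer than that.
  have hne : (F '' frontier (Metric.ball x r)).Nonempty := by
    rw [hfr]
    exact (NormedSpace.sphere_nonempty.2 hr.le).image _
  have hδ := (hclosed.notMem_iff_infDist_pos hne).1 hnot
  obtain ⟨k, hk, hk'⟩ := ((Metric.tendstoUniformly_iff.1 hF _ hδ).and
    (Metric.tendstoUniformly_iff.1 hF' r hr)).exists
  have hfib : {y ∈ Metric.ball x r | P k y = F x} = {(P k).symm (F x)} := by
    ext y
    simp only [mem_ofPred_eq, mem_singleton_iff, Equiv.eq_symm_apply]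
    refine ⟨fun h => h.2, fun h => ⟨?_, h⟩⟩
    have := hk' (F x)
    rw [F.symm_apply_apply, ← h, Equiv.symm_apply_apply, dist_comm] at this
    exact this
  refine ⟨hnot, P k, (hP k).1.contDiffOn, (hP k).1.continuous.continuousOn, fun y _ => ?_,
    fun y _ _ => (hdet k y).ne', ?_, ?_⟩
  · rw [← dist_eq_norm, dist_comm]; exact hk y
  · rw [hfib]; exact finite_singleton _
  · rw [hfib, finsum_mem_singleton, sign_pos (hdet k _)]; rfl

/-! ### The main theorem -/

theorem lemma2p1 (n : ℕ) (hn : 2 ≤ n) :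
    ∃ (Φ : unitCube n ≃ₜ unitCube n) (A : Set (EuclideanSpace ℝ (Fin n))),
      -- `Φ` is approximately differentiable a.e. and has Lusin's property (N)
      (∀ᵐ x ∂(volume.restrict (unitCube n)),
        ∃ L, HasApproxFDeriv (unitCube n) (extendById Φ) L x) ∧
      LusinN (unitCube n) (extendById Φ) ∧
      -- `A` is a Cantor set in the interior of the cube, of measure `2^{-n}`
      IsCompact A ∧ Nonempty (A ≃ₜ cantorSet) ∧ A ⊆ interior (unitCube n) ∧
      volume A = (1 / 2 : ℝ≥0∞) ^ n ∧
      -- `Φ` is the identity in a neighbourhood of the boundary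
      (∃ U, IsOpen U ∧ frontier (unitCube n) ⊆ U ∧
        ∀ x : unitCube n, (x : EuclideanSpace ℝ (Fin n)) ∈ U → Φ x = x) ∧
      -- `Φ` is the reflection on `A`, and maps `A` onto `A`
      (∀ x ∈ A, extendById Φ x = reflectLast x) ∧ extendById Φ '' A = A ∧
      -- `Φ` is a smooth diffeomorphism off `A`
      ContDiffOn ℝ ∞ (extendById Φ) (unitCube n \ A) ∧
      ContDiffOn ℝ ∞ (extendById Φ.symm) (unitCube n \ A) ∧
      -- the approximate derivative on `A`
      (∀ᵐ x ∂(volume.restrict A),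
        HasApproxFDeriv (unitCube n) (extendById Φ) (diagLast n) x) ∧
      -- `Φ` preserves orientation, but its Jacobian changes sign
      OrientationPreserving Φ ∧
      0 < volume {x ∈ unitCube n |
        ∃ L, HasApproxFDeriv (unitCube n) (extendById Φ) L x ∧ 0 < L.det} ∧
      0 < volume {x ∈ unitCube n |
        ∃ L, HasApproxFDeriv (unitCube n) (extendById Φ) L x ∧ L.det < 0} := by
  have hjl : (⟨0, by omega⟩ : Fin n) ≠ ⟨n - 1, by omega⟩ := by
    rw [Ne, Fin.ext_iff]; simp only; omega
  obtain ⟨P, F, hP, hPF, hPF', hPout, hFP, hFA⟩ := exists_reflecting_homeomorph hjl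
  replace hFA : ∀ x ∈ cantorDust n, F x = reflectLast x := fun x hx => by
    rw [hFA x hx, reflectLast_eq (l := ⟨n - 1, by omega⟩) (by simp only; omega)]
  have hFout : ∀ x ∉ cubeLevel n 0, F x = x := fun x hx => by rw [hFP 0 x hx, hPout 0 x hx]
  have hFQ : ∀ x ∉ unitCube n, F x = x := fun x hx =>
    hFout x fun h => hx (interior_subset (cubeLevel_zero_subset_interior n h))
  have hAint : cantorDust n ⊆ interior (unitCube n) :=
    (cantorDust_subset_cubeLevel n 0).trans (cubeLevel_zero_subset_interior n)
  have hAmeas : MeasurableSet (cantorDust n) := (isCompact_cantorDust n).measurableSet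
  have hQmeas : MeasurableSet (unitCube n) := (isClosed_unitCube n).measurableSet
  have hlevel : ∀ x ∉ cantorDust n, ∃ k, x ∉ cubeLevel n k := fun x hx => by
    rw [cantorDust_eq_iInter, mem_iInter] at hx
    push Not at hx
    exact hx
  have hsmooth : ∀ x ∉ cantorDust n, ContDiffAt ℝ ∞ F x := fun x hx => by
    obtain ⟨k, hk⟩ := hlevel x hx
    refine (hP k).1.contDiffAt.congr_of_eventuallyEq ?_
    filter_upwards [(isClosed_cubeLevel n k).isOpen_compl.mem_nhds hk] with y hy using hFP k y hy
  have hsmooth' : ∀ y ∉ cantorDust n, ContDiffAt ℝ ∞ F.symm y := fun y hy => by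
    -- `F` maps the dust into itself, so `F.symm y` is off the dust; near it `F` is some `P k`, and
    -- near `y` the inverse is `(P k).symm`.
    have hx : F.symm y ∉ cantorDust n := fun h => by
      have h1 := hFA _ h
      rw [F.apply_symm_apply] at h1
      exact hy (h1 ▸ reflectLast_mem_cantorDust h)
    obtain ⟨k, hk⟩ := hlevel _ hx
    refine (hP k).2.contDiffAt.congr_of_eventuallyEq ?_
    filter_upwards [F.symm.continuous.continuousAt.preimage_mem_nhds
      ((isClosed_cubeLevel n k).isOpen_compl.mem_nhds hk)] with z hz
    rw [Equiv.eq_symm_apply, ← hFP k _ hz, F.apply_symm_apply]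
  have hA : ∀ᵐ x ∂(volume.restrict (cantorDust n)),
      HasApproxFDeriv (unitCube n) F (diagLast n) x := by
    filter_upwards [ae_isDensityPoint (cantorDust n), ae_restrict_mem hAmeas] with x hd hx
    refine hasApproxFDeriv_of_affine_on (hAint.trans interior_subset) hAmeas hx hd fun y hy => ?_
    rw [hFA y hy, hFA x hx, reflectLast_sub]
  have hopen : ∀ x ∉ cantorDust n, x ∈ interior (unitCube n) →
      HasApproxFDeriv (unitCube n) F (fderiv ℝ F x) x := fun x hx hxi =>
    ((hsmooth x hx).differentiableAt (by simp)).hasFDerivAt.hasApproxFDeriv hQmeas hxi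
  refine ⟨restrictUnitCube F hFQ, cantorDust n, ?_⟩
  simp only [OrientationPreserving, extendById_restrictUnitCube, extendById_restrictUnitCube_symm]
  refine ⟨?_, ?_, isCompact_cantorDust n, nonempty_homeomorph_cantorDust (by omega), hAint,
    volume_cantorDust n, ⟨(cubeLevel n 0)ᶜ, (isClosed_cubeLevel n 0).isOpen_compl,
      fun x hx h => hx.2 (cubeLevel_zero_subset_interior n h),
      fun x hx => Subtype.ext (hFout x hx)⟩, hFA, ?_,
    fun x hx => (hsmooth x hx.2).contDiffWithinAt, fun x hx => (hsmooth' x hx.2).contDiffWithinAt,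
    hA, ?_, ?_, ?_⟩
  · have h1 : ∀ᵐ x ∂(volume : Measure (EuclideanSpace ℝ (Fin n))), x ∉ frontier (unitCube n) :=
      measure_eq_zero_iff_ae_notMem.1 ((convex_unitCube n).addHaar_frontier volume)
    rw [ae_restrict_iff' hAmeas] at hA
    rw [ae_restrict_iff' hQmeas]
    filter_upwards [h1, hA] with x hx hxA hxQ
    by_cases h : x ∈ cantorDust n
    · exact ⟨_, hxA h⟩
    · refine ⟨_, hopen x h ?_⟩
      by_contra hi
      exact hx ⟨subset_closure hxQ, hi⟩
  · intro N _ hN0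
    have h1 : volume (F '' (N \ cantorDust n)) = 0 :=
      addHaar_image_eq_zero_of_differentiableOn_of_addHaar_eq_zero volume
        (fun x hx => ((hsmooth x hx.2).differentiableAt (by simp)).differentiableWithinAt)
        (measure_mono_null sdiff_subset hN0)
    have h2 : volume (F '' (N ∩ cantorDust n)) = 0 := by
      rw [image_congr (g := reflectLast) fun x hx => hFA x hx.2]
      exact addHaar_image_eq_zero_of_differentiableOn_of_addHaar_eq_zero volume
        differentiable_reflectLast.differentiableOn (measure_mono_null inter_subset_left hN0)
    rw [← inter_union_sdiff N (cantorDust n), image_union]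
    exact measure_union_null h2 h1
  · refine Subset.antisymm ?_ fun x hx => ?_
    · rintro _ ⟨x, hx, rfl⟩
      simp only [hFA x hx]
      exact reflectLast_mem_cantorDust hx
    · refine ⟨reflectLast x, reflectLast_mem_cantorDust hx, ?_⟩
      simp only [hFA _ (reflectLast_mem_cantorDust hx), reflectLast_reflectLast]
  · intro x _ r hr
    refine isBrouwerDegree_one_of_tendstoUniformly (by omega) F hP (fun k y => ?_) hPF hPF' x hr
    -- Generation `0` is the cube `[1/8, 7/8]^n`, so every `P k` is the identity near the origin;
    -- this is the base point that fixes the sign of the determinant.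
    have h0 : (0 : EuclideanSpace ℝ (Fin n)) ∉ cubeLevel n 0 := fun h => by
      have := mem_cantorLevel_zero.1 (h ⟨0, by omega⟩)
      norm_num at this
    refine (hP k).det_pos (p := 0) ?_ y
    filter_upwards [(isClosed_cubeLevel n 0).isOpen_compl.mem_nhds h0] with z hz using hPout k z hz
  · have ho : IsOpen (interior (unitCube n) \ cubeLevel n 0) :=
      isOpen_interior.sdiff (isClosed_cubeLevel n 0)
    have hne : (interior (unitCube n) \ cubeLevel n 0).Nonempty := by
      -- Since `0 < 1/16 < 1/8`, this point lies inside the unit cube but off the generation `0`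
      -- cube, in the region where `F` is the identity.
      refine ⟨WithLp.toLp 2 fun _ => 1 / 16, mem_interior_unitCube fun i => ?_, fun h => ?_⟩
      · constructor <;> norm_num
      · have := abs_le.1 (mem_cantorLevel_zero.1 (h ⟨0, by omega⟩))
        norm_num at this
    refine (ho.measure_pos volume hne).trans_le (measure_mono fun x hx => ?_)
    refine ⟨interior_subset hx.1, ContinuousLinearMap.id ℝ _,
      HasFDerivAt.hasApproxFDeriv hQmeas hx.1 ((hasFDerivAt_id x).congr_of_eventuallyEq ?_), ?_⟩
    · filter_upwards [(isClosed_cubeLevel n 0).isOpen_compl.mem_nhds hx.2] with z hz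
        using hFout z hz
    · simp [ContinuousLinearMap.det]
  · have hpos : 0 < volume (cantorDust n) := by
      rw [volume_cantorDust]
      exact ENNReal.pow_pos (by simp) n
    rw [ae_restrict_iff' hAmeas] at hA
    refine hpos.trans_le (measure_mono_ae ?_)
    filter_upwards [hA] with x hx hxA
    exact ⟨interior_subset (hAint hxA), diagLast n, hx hxA, by
      rw [det_diagLast (by omega)]; norm_num⟩
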